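/- Let $R$ be a commutative noetherian ring satisfying $(\dagger)$ every (not necessarily finitely generated) projective $R$-module is free, and for every torsion-free abelian group $Q$, every finitely generated projective module over the group algebra $R[Q]$ is extended from $R$. Here, for an $R$-algebra $B$, a finitely generated projective $B$-module is *extended from $R$* if it is isomorphic to $N\otimes_R B$ for some finitely generated projective $R$-module $N$. Let $P$ be a finitely generated abelian group and $G=\operatorname{Spec} R[P]$ the corresponding diagonalizable group scheme, where $R[P]$ has its usual Hopf algebra structure: each basis element $e_p$ ($p\in P$) has comultiplication $e_p\otimes e_p$ and counit $1$. Let $L$ be a free abelian group of finite rank, and let $\sigma\subseteq L_{\mathbb Q}=L\otimes_{\mathbb Z}\mathbb Q$ be an intersection of finitely many half-spaces $\{y : l(y)\ge 0\}$, $l$ a linear functional on $L_{\mathbb Q}$, such that $\sigma$ spans $L_{\mathbb Q}$ (the cone $\sigma$ may contain lines). A *face* of $\sigma$ is a subset $\sigma\cap l^{-1}(0)$, where $l$ is a linear functional that is nonnegative on $\sigma$; in particular $\sigma$ is a face of itself. For a face $\tau$ of $\sigma$ put $A_\tau=R[\tau\cap L]$ (monoid algebra), and put $A=A_\sigma$.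 Let $\psi:L\to P$ be a group homomorphism. It makes each $\operatorname{Spec} A_\tau$ a scheme with $G$-action, through the coaction $$\phi_\tau:A_\tau\to R[P]\otimes_R A_\tau,\qquad e_m\mapsto e_{\psi(m)}\otimes e_m ,$$ and we let $(A_\tau)^G=\{a\in A_\tau : \phi_\tau(a)=1\otimes a\}$ be the ring of invariants. An *$R$-$G$-module* is an $R$-module $M$ with a coassociative and counital $R$-linear map $\rho:M\to R[P]\otimes_R M$. An *$A$-$G$-module* is an $A$-module $M$ with an $R$-$G$-module structure $\rho$ such that $\rho(am)=\phi_\sigma(a)\,\rho(m)$ for all $a\in A$, $m\in M$. For an $R$-$G$-module $F$, the module $F\otimes_R A$ is an $A$-$G$-module with the tensor product coaction. An $A$-$G$-module (respectively $R$-$G$-module) is called finitely generated or projective if it is so as an $A$-module (respectively $R$-module). Assume that for every face $\tau$ of $\sigma$, all finitely generated projective modules over $A_\tau$ and all finitely generated projective modules over $(A_\tau)^G$ are extended from $R$. Then every finitely generated projective $A$-$G$-module $E$ is equivariantly extended from $R$: there are a finitely generated projective $R$-$G$-module $F$ and an isomorphism $E\cong F\otimes_R A$ of $A$-$G$-modules.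 -/

import Mathlib

open scoped TensorProduct

universe u v w x

/-! ### Coactions of Hopf algebras

An affine group scheme `G = Spec H` over `R` is represented by its coordinate Hopf algebra `H`;
`G`-modules are comodules over `H`. -/

section Coactions

variable {R : Type*} [CommRing R] {H : Type*} [CommRing H] [Bialgebra R H]
variable {A : Type*} [CommRing A] [Algebra R A]
variable {M : Type*} [AddCommGroup M] [Module R M]
variable {N : Type*} [AddCommGroup N] [Module R N]

/-- `ρ : M → H ⊗ M` makes the `R`-module `M` a (left) comodule over `H`, that is, an
`R`-`G`-module for `G = Spec H`: the map is coassociative and counital. -/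
structure IsComodule (ρ : M →ₗ[R] H ⊗[R] M) : Prop where
  coassoc : (TensorProduct.assoc R H H M).toLinearMap ∘ₗ
    (Coalgebra.comul (R := R) (A := H)).rTensor M ∘ₗ ρ = ρ.lTensor H ∘ₗ ρ
  counit : (TensorProduct.lid R M).toLinearMap ∘ₗ
    (Coalgebra.counit (R := R) (A := H)).rTensor M ∘ₗ ρ = LinearMap.id

/-- `ρ : M → H ⊗ M` and `ρ' : N → H ⊗ N` are compatible with the linear map `f : M → N`, that
is, `f` is a homomorphism of `R`-`G`-modules. -/
def IsEquivariantMap (ρ : M →ₗ[R] H ⊗[R] M) (ρ' : N →ₗ[R] H ⊗[R] N) (f : M →ₗ[R] N) : Prop :=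
  ρ' ∘ₗ f = f.lTensor H ∘ₗ ρ

/-- `φ : A → H ⊗ A` is an action of `G = Spec H` on `Spec A`, that is, `(A, φ)` is an
`R`-`G`-algebra. -/
def IsAlgebraCoaction (φ : A →ₐ[R] H ⊗[R] A) : Prop :=
  IsComodule φ.toLinearMap

/-- The ring of invariants `A^G = {a | φ a = 1 ⊗ a}`. -/
def invariantSubalgebra (φ : A →ₐ[R] H ⊗[R] A) : Subalgebra R A :=
  AlgHom.equalizer φ Algebra.TensorProduct.includeRight

theorem mem_invariantSubalgebra (φ : A →ₐ[R] H ⊗[R] A) (a : A) :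
    a ∈ invariantSubalgebra φ ↔ φ a = 1 ⊗ₜ[R] a :=
  Iff.rfl

section AG

variable [Module A M] [IsScalarTower R A M]

variable (R H A M) in
/-- The multiplication of the ring `H ⊗ A` on `H ⊗ M`, where `M` is an `A`-module:
`(h ⊗ a) • (k ⊗ m) = hk ⊗ am`. -/
noncomputable def tensorAction : H ⊗[R] A →ₗ[R] H ⊗[R] M →ₗ[R] H ⊗[R] M :=
  TensorProduct.map₂ (LinearMap.mul R H) (Algebra.lsmul R R M : A →ₐ[R] Module.End R M).toLinearMap

@[simp]
theorem tensorAction_tmul (h k : H) (a : A) (m : M) :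
    tensorAction R H A M (h ⊗ₜ[R] a) (k ⊗ₜ[R] m) = (h * k) ⊗ₜ[R] (a • m) := by
  simp [tensorAction]

/-- `(M, ρ)` is an `A`-`G`-module over the `R`-`G`-algebra `(A, φ)`: it is an `R`-`G`-module and
`ρ (a m) = φ a · ρ m`. -/
structure IsEquivariantModule (φ : A →ₐ[R] H ⊗[R] A) (ρ : M →ₗ[R] H ⊗[R] M) : Prop where
  isComodule : IsComodule ρ
  map_smul : ∀ (a : A) (m : M), ρ (a • m) = tensorAction R H A M (φ a) (ρ m)

end AG

/-- For an `R`-`G`-algebra `(A, φ)` and an `R`-`G`-module `(N, ρ)`, the coaction on the extension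
of scalars `A ⊗ N`: if `φ a = ∑ hᵢ ⊗ aᵢ` and `ρ n = ∑ kⱼ ⊗ nⱼ`, it sends `a ⊗ n` to
`∑ hᵢ kⱼ ⊗ (aᵢ ⊗ nⱼ)`. -/
noncomputable def baseChangeCoaction (φ : A →ₐ[R] H ⊗[R] A) (ρ : N →ₗ[R] H ⊗[R] N) :
    A ⊗[R] N →ₗ[R] H ⊗[R] (A ⊗[R] N) :=
  (LinearMap.mul' R H).rTensor (A ⊗[R] N) ∘ₗ
    (TensorProduct.tensorTensorTensorComm R H A H N).toLinearMap ∘ₗ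
      TensorProduct.map φ.toLinearMap ρ

end Coactions

/-! ### Modules extended from the base -/

/-- Every finitely generated projective `B`-module is extended from `R`: it is isomorphic to
`B ⊗ N` for some finitely generated projective `R`-module `N`. -/
def FGProjectivesExtended (R : Type u) [CommRing R] (B : Type v) [CommRing B] [Algebra R B] :
    Prop :=
  ∀ (M : Type v) [AddCommGroup M] [Module B M] [Module.Finite B M] [Module.Projective B M],
    ∃ (N : Type u) (_ : AddCommGroup N) (_ : Module R N),
      Module.Finite R N ∧ Module.Projective R N ∧ Nonempty (M ≃ₗ[B] B ⊗[R] N)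

/-- The condition `(†)`: every (not necessarily finitely generated) projective `R`-module is free,
and for every torsion-free abelian group `Q`, every finitely generated projective module over the
group algebra `R[Q]` is extended from `R`. -/
structure SatisfiesDagger (R : Type u) [CommRing R] : Prop where
  free_of_projective : ∀ (M : Type u) [AddCommGroup M] [Module R M] [Module.Projective R M],
    Module.Free R M
  extended : ∀ (Q : Type u) [AddCommGroup Q] [IsAddTorsionFree Q],
    FGProjectivesExtended R (AddMonoidAlgebra R Q)

/-! ### Cones, faces and affine `G`-toric schemes -/

section Toric

variable {L : Type*} [AddCommGroup L]

/-- `τ` is a face of the cone `σ`: it is `σ ∩ l⁻¹(0)` for a linear functional `l` that is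
nonnegative on `σ`. (`l = 0` gives `σ` itself.) -/
def IsConeFace {V : Type*} [AddCommGroup V] [Module ℚ V] (τ σ : PointedCone ℚ V) : Prop :=
  ∃ l : V →ₗ[ℚ] ℚ, (∀ y ∈ σ, 0 ≤ l y) ∧ ∀ y, y ∈ τ ↔ y ∈ σ ∧ l y = 0

/-- A polyhedral cone in `V`: an intersection of finitely many half-spaces
`{y | 0 ≤ l y}`. -/
def IsPolyhedralCone {V : Type*} [AddCommGroup V] [Module ℚ V] (σ : PointedCone ℚ V) : Prop :=
  σ.DualFG (LinearMap.id : Module.Dual ℚ V →ₗ[ℚ] V →ₗ[ℚ] ℚ)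

/-- The monoid `σ ∩ L` of lattice points of a cone `σ` in `L_ℚ = ℚ ⊗ L`. -/
def latticePoints (σ : PointedCone ℚ (ℚ ⊗[ℤ] L)) : AddSubmonoid L where
  carrier := {m | (1 : ℚ) ⊗ₜ[ℤ] m ∈ σ}
  zero_mem' := by simp
  add_mem' {a b} ha hb := by
    simp only [Set.mem_ofPred_eq, TensorProduct.tmul_add] at *
    exact add_mem ha hb

/-- The monoid algebra `R[σ ∩ L]`, the coordinate ring of the affine toric scheme `X_σ`. -/
abbrev ToricRing (R : Type*) [CommRing R] (σ : PointedCone ℚ (ℚ ⊗[ℤ] L)) : Type _ :=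
  AddMonoidAlgebra R (latticePoints σ)

variable (R : Type*) [CommRing R]

/-- For a homomorphism of monoids `f : Q → P`, the coaction `R[Q] → R[P] ⊗ R[Q]`,
`e_q ↦ e_{f q} ⊗ e_q`, induced by the graph of `f`. -/
noncomputable def graphCoaction {Q P : Type*} [AddCommMonoid Q] [AddCommGroup P] (f : Q →+ P) :
    AddMonoidAlgebra R Q →ₐ[R] AddMonoidAlgebra R P ⊗[R] AddMonoidAlgebra R Q :=
  AddMonoidAlgebra.lift R _ Q
    { toFun := fun q => AddMonoidAlgebra.single (f q.toAdd) 1 ⊗ₜ AddMonoidAlgebra.single q.toAdd 1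
      map_one' := by
        simp [AddMonoidAlgebra.one_def, Algebra.TensorProduct.one_def]
      map_mul' := fun a b => by
        simp [AddMonoidAlgebra.single_mul_single] }

/-- The action of `G = Spec R[P]` on `X_σ` given by `ψ : L → P`: the action of the big torus
`Spec R[L]` on `X_σ` (the graph of the inclusion `σ ∩ L ⊆ L`) composed with `ψ`. -/
noncomputable def toricCoaction {P : Type*} [AddCommGroup P] (ψ : L →+ P)
    (σ : PointedCone ℚ (ℚ ⊗[ℤ] L)) :
    ToricRing R σ →ₐ[R] AddMonoidAlgebra R P ⊗[R] ToricRing R σ :=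
  (Algebra.TensorProduct.map (AddMonoidAlgebra.mapDomainAlgHom R R ψ)
    (AlgHom.id R (ToricRing R σ))).comp (graphCoaction R (latticePoints σ).subtype)

theorem toricCoaction_single {P : Type*} [AddCommGroup P] (ψ : L →+ P)
    (σ : PointedCone ℚ (ℚ ⊗[ℤ] L)) (m : latticePoints σ) :
    toricCoaction R ψ σ (AddMonoidAlgebra.single m 1) =
      AddMonoidAlgebra.single (ψ m) 1 ⊗ₜ AddMonoidAlgebra.single m 1 := by
  simp [toricCoaction, graphCoaction]

/-- The ring `R[σ ∩ L]` with the action given by `ψ` is an `R`-`G`-algebra. -/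
theorem isAlgebraCoaction_toricCoaction {P : Type*} [AddCommGroup P] (ψ : L →+ P)
    (σ : PointedCone ℚ (ℚ ⊗[ℤ] L)) : IsAlgebraCoaction (toricCoaction R ψ σ) := by
  constructor
  · ext m
    simp [toricCoaction_single]
  · ext m
    simp [toricCoaction_single]

end Toric

/-! A coaction of `R[P]` is a `P`-grading, so `E` is a graded module over `R[σ ∩ L]`, and it
suffices to find a homogeneous basis: its `R`-span is then the comodule `F`. Homogeneous generators
and the degree-preserving part of a section present `E` as the image of a graded idempotent matrix
`e` (`exists_homogeneous_projector`). The heart is `exists_splits`: `e = X * Y` with `Y * X = 1` and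
`X`, `Y` graded.

The monoid is cut out by integral functionals `l j ≥ 0`. A set `Z` of indices gives a face, and
deleting all monomials off a face is a ring retraction `eps`. On the smallest face, the group of
units, rescaling by unit monomials makes `e` block diagonal with blocks over the ring of invariants.
These split, because projectives over the invariants are extended from `R` and projective
`R`-modules are free (`exists_splits_units`). The splitting is then propagated to larger faces with
the same weights `p` (`splits_of_splits_units`). Splittings on the facets `l k = 0` patch to graded
`X`, `Y` that are mutually inverse on every facet (`exists_splitting_on_faces`). Two cases remain.

If some `l k` vanishes on all invariant monomials of the face, no monomial with `l k > 0` is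
invariant. Graded square matrices supported on such monomials are nilpotent, and a finite geometric
series corrects `Y` (`splits_of_invariants_in_face`).

Otherwise there is an invariant monomial `s` in the interior (`splits_of_interior`). The geometric
series now only makes the errors `1 - H * X` and `V = e - X * H` as deep in the interior as desired.
Allowing Laurent monomials, the weights can be normalized as on the unit face; a large multiple of
`s` and the depth of `V` make it possible to glue an integral idempotent that is Laurent-isomorphic
to `e`. It splits by the hypothesis on invariants (`exists_laurent_splitting`). The resulting
Laurent splitting differs from `X` by an integral matrix `C`, invertible on all facets. Up to graded
invertible matrices `C` is diagonal to high order, and diagonal matrices are unaffected by undoing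
the normalization. The corrected splitting then has no poles (`mem_face_of_mul_mem`), so it is a
splitting over the face. -/

namespace GradedMatrix

open AddMonoidAlgebra

/-! ### Supports of elements of a monoid algebra -/

section Support

variable {R : Type*} [CommRing R] {L : Type*}

/-- The support of `x` is contained in `D`. -/
def SuppIn (D : Set L) (x : AddMonoidAlgebra R L) : Prop :=
  ∀ m, x.coeff m ≠ 0 → m ∈ D

theorem SuppIn.mono {D D' : Set L} {x : AddMonoidAlgebra R L} (h : SuppIn D x) (hD : D ⊆ D') :
    SuppIn D' x :=
  fun m hm => hD (h m hm)

theorem SuppIn.mul [AddMonoid L] {D D' D'' : Set L} {x y : AddMonoidAlgebra R L} (hx : SuppIn D x)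
    (hy : SuppIn D' y) (hD : ∀ a ∈ D, ∀ b ∈ D', a + b ∈ D'') : SuppIn D'' (x * y) := by
  classical
  intro m hm
  have := support_coeff_mul_subset x y (Finsupp.mem_support_iff.2 hm)
  obtain ⟨a, ha, b, hb, rfl⟩ := Finset.mem_add.1 this
  exact hD a (hx a (Finsupp.mem_support_iff.1 ha)) b (hy b (Finsupp.mem_support_iff.1 hb))

theorem suppIn_zero (D : Set L) : SuppIn D (0 : AddMonoidAlgebra R L) := by
  intro m hm; simp at hm

theorem SuppIn.add {D : Set L} {x y : AddMonoidAlgebra R L} (hx : SuppIn D x)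
    (hy : SuppIn D y) : SuppIn D (x + y) := by
  intro m hm
  by_cases h : x.coeff m = 0
  · exact hy m fun h' => hm (by simp [h, h'])
  · exact hx m h

theorem SuppIn.neg {D : Set L} {x : AddMonoidAlgebra R L} (hx : SuppIn D x) : SuppIn D (-x) := by
  intro m hm
  exact hx m fun h' => hm (by simp [h'])

theorem SuppIn.sum {κ : Type*} {D : Set L} {s : Finset κ} {f : κ → AddMonoidAlgebra R L}
    (h : ∀ i ∈ s, SuppIn D (f i)) : SuppIn D (∑ i ∈ s, f i) := by
  classical
  induction s using Finset.induction_on with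
  | empty => simpa using suppIn_zero D
  | insert a s ha ih =>
    rw [Finset.sum_insert ha]
    exact (h a (by simp)).add (ih fun i hi => h i (by simp [hi]))

theorem suppIn_single {D : Set L} {m : L} (hm : m ∈ D) (r : R) :
    SuppIn D (single m r) := by
  classical
  intro m' h
  rw [coeff_single, Finsupp.single_apply] at h
  split_ifs at h with h'
  · exact h' ▸ hm
  · exact absurd rfl h

theorem suppIn_one [AddCommGroup L] {D : Set L} (h : (0 : L) ∈ D) : SuppIn D (1 : AddMonoidAlgebra R L) :=
  suppIn_single h 1

theorem SuppIn.eq_zero {x : AddMonoidAlgebra R L} (h : SuppIn (∅ : Set L) x) : x = 0 := by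
  ext m
  by_contra hm
  exact h m hm

end Support

/-! ### Faces of the monoid, their linear hulls and depth in the interior -/

section Faces

variable {L : Type*} [AddCommGroup L] {ι : Type*} (l : ι → L →+ ℤ)

/-- The face of the monoid `{m | ∀ j, 0 ≤ l j m}` cut out by `l j = 0` for `j ∈ Z`. -/
def face (Z : Finset ι) : AddSubmonoid L where
  carrier := {m | (∀ j, 0 ≤ l j m) ∧ ∀ j ∈ Z, l j m = 0}
  zero_mem' := by simp
  add_mem' {a b} ha hb := by
    refine ⟨fun j => ?_, fun j hj => ?_⟩
    · rw [map_add]; exact add_nonneg (ha.1 j) (hb.1 j)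
    · rw [map_add, ha.2 j hj, hb.2 j hj, add_zero]

/-- The subgroup cut out by `l j = 0` for `j ∈ Z`. -/
def lineal (Z : Finset ι) : AddSubgroup L where
  carrier := {m | ∀ j ∈ Z, l j m = 0}
  zero_mem' := by simp
  add_mem' {a b} ha hb j hj := by rw [map_add, ha j hj, hb j hj, add_zero]
  neg_mem' {a} ha j hj := by rw [map_neg, ha j hj, neg_zero]

/-- The elements of the face of depth at least `t` in the interior. -/
def interior (Z : Finset ι) (t : ℤ) : Set L :=
  {m | m ∈ face l Z ∧ ∀ j ∉ Z, t ≤ l j m}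

variable {l}

theorem mem_face {Z : Finset ι} {m : L} :
    m ∈ face l Z ↔ (∀ j, 0 ≤ l j m) ∧ ∀ j ∈ Z, l j m = 0 := Iff.rfl

theorem face_le_lineal (Z : Finset ι) : (face l Z : Set L) ⊆ lineal l Z := fun _ h => h.2

theorem face_anti {Z Z' : Finset ι} (h : Z ⊆ Z') : (face l Z' : Set L) ⊆ face l Z :=
  fun _ hm => ⟨hm.1, fun j hj => hm.2 j (h hj)⟩

theorem interior_subset (Z : Finset ι) (t : ℤ) : interior l Z t ⊆ face l Z := fun _ h => h.1

theorem interior_anti (Z : Finset ι) {t t' : ℤ} (h : t ≤ t') :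
    interior l Z t' ⊆ interior l Z t :=
  fun _ hm => ⟨hm.1, fun j hj => h.trans (hm.2 j hj)⟩

theorem interior_add {Z : Finset ι} {t t' : ℤ} {a b : L} (ha : a ∈ interior l Z t)
    (hb : b ∈ interior l Z t') : a + b ∈ interior l Z (t + t') :=
  ⟨add_mem ha.1 hb.1, fun j hj => by rw [map_add]; exact add_le_add (ha.2 j hj) (hb.2 j hj)⟩

theorem face_add_interior {Z : Finset ι} {t : ℤ} {a b : L} (ha : a ∈ face l Z)
    (hb : b ∈ interior l Z t) : a + b ∈ interior l Z t :=
  ⟨add_mem ha hb.1, fun j hj => by rw [map_add]; linarith [hb.2 j hj, ha.1 j]⟩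

end Faces

/-! ### Retractions onto face rings -/

section Eps

variable {R : Type*} [CommRing R] {L : Type*} [AddCommGroup L] {ι : Type*} (l : ι → L →+ ℤ)

open Classical in
/-- The projection of `R[L]` onto the span of the monomials `m` with `l j m = 0` for `j ∈ Z`. -/
noncomputable def eps (Z : Finset ι) : AddMonoidAlgebra R L →+ AddMonoidAlgebra R L where
  toFun x := ofCoeff (x.coeff.filter fun m => ∀ j ∈ Z, l j m = 0)
  map_zero' := by ext; simp [Finsupp.filter_apply]
  map_add' x y := by simp [Finsupp.filter_add]

open Classical in
theorem coeff_eps (Z : Finset ι) (x : AddMonoidAlgebra R L) (m : L) :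
    (eps l Z x).coeff m = if ∀ j ∈ Z, l j m = 0 then x.coeff m else 0 := by
  simp [eps, Finsupp.filter_apply]

variable {l}

theorem SuppIn.eps {D : Set L} {x : AddMonoidAlgebra R L} (h : SuppIn D x) (Z : Finset ι) :
    SuppIn {m ∈ D | ∀ j ∈ Z, l j m = 0} (eps l Z x) := by
  classical
  intro m hm
  rw [coeff_eps] at hm
  split_ifs at hm with h'
  · exact ⟨h m hm, h'⟩
  · exact absurd rfl hm

theorem eps_eq_self {Z : Finset ι} {x : AddMonoidAlgebra R L}
    (h : SuppIn {m | ∀ j ∈ Z, l j m = 0} x) : eps l Z x = x := by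
  classical
  ext m
  rw [coeff_eps]
  split_ifs with h'
  · rfl
  · by_contra hm
    exact h' (h m (Ne.symm hm))

theorem eps_eq_zero {Z : Finset ι} {x : AddMonoidAlgebra R L}
    (h : SuppIn {m | ∃ j ∈ Z, l j m ≠ 0} x) : eps l Z x = 0 := by
  classical
  ext m
  rw [coeff_eps]
  split_ifs with h'
  · by_contra hm
    obtain ⟨j, hj, hj'⟩ := h m hm
    exact hj' (h' j hj)
  · rfl

theorem suppIn_of_eps_eq_zero {Z : Finset ι} {x : AddMonoidAlgebra R L}
    (h : eps l Z x = 0) : SuppIn {m | ∃ j ∈ Z, l j m ≠ 0} x := by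
  classical
  intro m hm
  by_contra h'
  have h'' : ∀ j ∈ Z, l j m = 0 := fun j hj => by
    by_contra hne
    exact h' ⟨j, hj, hne⟩
  have := coeff_eps l Z x m
  rw [h, if_pos h''] at this
  exact hm (by simpa using this.symm)

theorem eps_eps [DecidableEq ι] (Z Z' : Finset ι) (x : AddMonoidAlgebra R L) :
    eps l Z (eps l Z' x) = eps l (Z ∪ Z') x := by
  classical
  ext m
  simp only [coeff_eps, Finset.mem_union]
  by_cases h : ∀ j ∈ Z, l j m = 0 <;> by_cases h' : ∀ j ∈ Z', l j m = 0
  · rw [if_pos h, if_pos h', if_pos]; rintro j (hj | hj); exacts [h j hj, h' j hj]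
  · rw [if_pos h, if_neg h', if_neg]; exact fun hh => h' fun j hj => hh j (.inr hj)
  · rw [if_neg h, if_neg]; exact fun hh => h fun j hj => hh j (.inl hj)
  · rw [if_neg h, if_neg]; exact fun hh => h fun j hj => hh j (.inl hj)

theorem eps_one (Z : Finset ι) : eps l Z (1 : AddMonoidAlgebra R L) = 1 :=
  eps_eq_self (suppIn_one (by simp))

theorem suppIn_sub_eps {D : Set L} {x : AddMonoidAlgebra R L} (h : SuppIn D x) (Z : Finset ι) :
    SuppIn {m ∈ D | ∃ j ∈ Z, l j m ≠ 0} (x - eps l Z x) := by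
  classical
  intro m hm
  rw [coeff_sub, Finsupp.sub_apply, coeff_eps] at hm
  split_ifs at hm with h'
  · simp at hm
  · refine ⟨h m (by simpa using hm), ?_⟩
    by_contra hne
    exact h' fun j hj => by_contra fun h0 => hne ⟨j, hj, h0⟩

/-- Among elements supported in the cone, the monomials on which some `l j`, `j ∈ Z`, is positive
span an ideal: nonnegative values cannot cancel. On general Laurent elements multiplicativity would
fail. -/
theorem eps_mul {Z : Finset ι} {x y : AddMonoidAlgebra R L}
    (hx : SuppIn {m | ∀ j, 0 ≤ l j m} x) (hy : SuppIn {m | ∀ j, 0 ≤ l j m} y) :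
    eps l Z (x * y) = eps l Z x * eps l Z y := by
  have key : x * y = eps l Z x * eps l Z y +
      (eps l Z x * (y - eps l Z y) + (x - eps l Z x) * y) := by ring
  have h0 : eps l Z (eps l Z x * (y - eps l Z y) + (x - eps l Z x) * y) = 0 := by
    refine eps_eq_zero (SuppIn.add ?_ ?_)
    · refine (hx.eps Z).mul (suppIn_sub_eps hy Z) ?_
      rintro a ⟨ha, ha'⟩ b ⟨hb, j, hj, hb'⟩
      exact ⟨j, hj, by rw [map_add, ha' j hj, zero_add]; exact hb'⟩
    · refine (suppIn_sub_eps hx Z).mul hy ?_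
      rintro a ⟨ha, j, hj, ha'⟩ b hb
      refine ⟨j, hj, ?_⟩
      have h1 := ha j
      have h2 := hb j
      rw [map_add]
      omega
  conv_lhs => rw [key]
  rw [map_add, h0, add_zero]
  refine eps_eq_self ((hx.eps Z).mul (hy.eps Z) ?_)
  rintro a ⟨ha, ha'⟩ b ⟨hb, hb'⟩ j hj
  rw [map_add, ha' j hj, hb' j hj, add_zero]

end Eps

/-! ### Graded matrices -/

section GradedMatrices

variable {R : Type*} [CommRing R] {L : Type*} [AddCommGroup L] {P : Type*} [AddCommGroup P]
variable {I J K : Type*}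

/-- Matrices over `R[L]` whose `(i, j)` entry is supported on the elements of `D` of degree
`w' j - w i`. -/
def Gr (R : Type*) [CommRing R] (D : Set L) (ψ : L →+ P) (w : I → P) (w' : J → P) :
    AddSubgroup (Matrix I J (AddMonoidAlgebra R L)) where
  carrier := {M | ∀ i j, SuppIn {m | m ∈ D ∧ ψ m = w' j - w i} (M i j)}
  zero_mem' _ _ := suppIn_zero _
  add_mem' h h' i j := (h i j).add (h' i j)
  neg_mem' h i j := (h i j).neg

variable {ψ : L →+ P} {w : I → P} {w' : J → P} {w'' : K → P}

theorem Gr_mono {D D' : Set L} (h : D ⊆ D') : Gr R D ψ w w' ≤ Gr R D' ψ w w' :=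
  fun _ hM i j => (hM i j).mono fun _ hm => ⟨h hm.1, hm.2⟩

theorem Gr_mul [Fintype J] {D D' D'' : Set L} {M : Matrix I J (AddMonoidAlgebra R L)}
    {M' : Matrix J K (AddMonoidAlgebra R L)}
    (hM : M ∈ Gr R D ψ w w') (hM' : M' ∈ Gr R D' ψ w' w'')
    (hD : ∀ a ∈ D, ∀ b ∈ D', a + b ∈ D'') : M * M' ∈ Gr R D'' ψ w w'' := by
  intro i k
  rw [Matrix.mul_apply]
  refine SuppIn.sum fun j _ => (hM i j).mul (hM' j k) ?_
  rintro a ⟨ha, ha'⟩ b ⟨hb, hb'⟩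
  exact ⟨hD a ha b hb, by rw [map_add, ha', hb']; abel⟩

theorem Gr_mul_mem [Fintype J] {S : AddSubmonoid L} {M : Matrix I J (AddMonoidAlgebra R L)}
    {M' : Matrix J K (AddMonoidAlgebra R L)}
    (hM : M ∈ Gr R S ψ w w') (hM' : M' ∈ Gr R S ψ w' w'') : M * M' ∈ Gr R S ψ w w'' :=
  Gr_mul hM hM' fun _ ha _ hb => add_mem ha hb

theorem one_mem_Gr [DecidableEq I] {D : Set L} (h : (0 : L) ∈ D) : 1 ∈ Gr R D ψ w w := by
  intro i j
  rw [Matrix.one_apply]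
  split_ifs with hij
  · subst hij
    exact suppIn_one (by simpa using h)
  · exact suppIn_zero _

theorem diagonal_mem_Gr [DecidableEq I] {D : Set L} {M : Matrix I I (AddMonoidAlgebra R L)}
    (hM : M ∈ Gr R D ψ w w) : Matrix.diagonal (fun i => M i i) ∈ Gr R D ψ w w := by
  intro i j
  rw [Matrix.diagonal_apply]
  split_ifs with hij
  · subst hij
    exact hM i i
  · exact suppIn_zero _

theorem single_mem_Gr [DecidableEq I] {D : Set L} {M : Matrix I I (AddMonoidAlgebra R L)}
    (hM : M ∈ Gr R D ψ w w) (i j : I) : Matrix.single i j (M i j) ∈ Gr R D ψ w w := by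
  intro i' j'
  rw [Matrix.single_apply]
  split_ifs with hij
  · rw [← hij.1, ← hij.2]; exact hM i j
  · exact suppIn_zero _

variable (R) in
/-- The ring of square graded matrices over `R[S]`. -/
def grRing [Fintype I] [DecidableEq I] (S : AddSubmonoid L) (ψ : L →+ P) (w : I → P) :
    Subring (Matrix I I (AddMonoidAlgebra R L)) where
  __ := Gr R (S : Set L) ψ w w
  mul_mem' h h' := Gr_mul_mem h h'
  one_mem' := one_mem_Gr S.zero_mem

theorem mem_grRing [Fintype I] [DecidableEq I] {S : AddSubmonoid L}
    {M : Matrix I I (AddMonoidAlgebra R L)} :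
    M ∈ grRing R S ψ w ↔ M ∈ Gr R (S : Set L) ψ w w := Iff.rfl

/-- Relating `i` to `j` when `D` contains an element of degree `w j - w i` gives a strict partial
order: transitive because `D` is closed under addition, irreflexive because `D` has no element of
degree `0`. So `N` is strictly triangular for this order. -/
theorem exists_pow_eq_zero [Fintype I] [DecidableEq I] {D : Set L}
    (hD : ∀ a ∈ D, ∀ b ∈ D, a + b ∈ D) (h0 : ∀ m ∈ D, ψ m ≠ 0)
    {N : Matrix I I (AddMonoidAlgebra R L)} (hN : N ∈ Gr R D ψ w w) :
    N ^ (Fintype.card I + 1) = 0 := by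
  classical
  let rel : I → I → Prop := fun i j => ∃ m ∈ D, ψ m = w j - w i
  have trans : ∀ i j k, rel i j → rel j k → rel i k := by
    rintro i j k ⟨m, hm, h⟩ ⟨m', hm', h'⟩
    exact ⟨m + m', hD _ hm _ hm', by rw [map_add, h, h']; abel⟩
  have irrefl : ∀ i, ¬ rel i i := by
    rintro i ⟨m, hm, h⟩
    exact h0 m hm (by simpa using h)
  -- The number of elements above `i` drops strictly along the relation, so it bounds the length of
  -- a nonzero product of entries.
  let ht : I → ℕ := fun i => (Finset.univ.filter fun j => rel i j).card
  have ht_lt : ∀ i j, rel i j → ht j < ht i := by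
    intro i j hij
    refine Finset.card_lt_card ⟨?_, ?_⟩
    · intro k hk
      simp only [Finset.mem_filter, Finset.mem_univ, true_and] at hk ⊢
      exact trans i j k hij hk
    · intro hsub
      have := hsub (Finset.mem_filter.2 ⟨Finset.mem_univ j, hij⟩)
      exact irrefl j (Finset.mem_filter.1 this).2
  have hrel : ∀ i j, N i j ≠ 0 → rel i j := by
    intro i j hij
    by_contra hne
    refine hij (SuppIn.eq_zero ((hN i j).mono ?_))
    rintro m ⟨hm, hm'⟩
    exact hne ⟨m, hm, hm'⟩
  have key : ∀ t i j, (N ^ t) i j ≠ 0 → ht j + t ≤ ht i := by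
    intro t
    induction t with
    | zero =>
      intro i j h
      rw [pow_zero, Matrix.one_apply] at h
      split_ifs at h with hij
      · subst hij; simp
      · exact absurd rfl h
    | succ t ih =>
      intro i j h
      rw [pow_succ', Matrix.mul_apply] at h
      obtain ⟨k, -, hk⟩ := Finset.exists_ne_zero_of_sum_ne_zero h
      have h1 := ht_lt i k (hrel i k (left_ne_zero_of_mul hk))
      have h2 := ih k j (right_ne_zero_of_mul hk)
      omega
  ext1 i j
  by_contra h
  have h1 := key _ i j h
  have h2 : ht i ≤ Fintype.card I := Finset.card_le_univ _
  omega

theorem pow_mem_interior [Fintype I] [DecidableEq I] {ι : Type*} {l : ι → L →+ ℤ} {Z : Finset ι}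
    {N : Matrix I I (AddMonoidAlgebra R L)} (hN : N ∈ Gr R (interior l Z 1) ψ w w) (t : ℕ) :
    N ^ t ∈ Gr R (interior l Z t) ψ w w := by
  induction t with
  | zero => exact one_mem_Gr ⟨zero_mem _, by simp⟩
  | succ t ih =>
    rw [pow_succ]
    refine Gr_mul ih hN fun a ha b hb => ?_
    push_cast
    exact interior_add ha hb

end GradedMatrices

/-! ### Improving an approximate inverse -/

section ApproximateInverse

variable {A : Type*} [CommRing A] {I J : Type*} [Fintype I] [Fintype J] [DecidableEq J]

/-- A truncated geometric series turning an approximate inverse `Y` of `X` into a better one. -/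
noncomputable def improve (X : Matrix I J A) (Y : Matrix J I A) (τ : ℕ) : Matrix J I A :=
  (∑ t ∈ Finset.range τ, (1 - Y * X) ^ t) * Y

theorem improve_mul (X : Matrix I J A) (Y : Matrix J I A) (τ : ℕ) :
    improve X Y τ * X = 1 - (1 - Y * X) ^ τ := by
  rw [improve, Matrix.mul_assoc, ← geom_sum_mul_neg, sub_sub_cancel]

/-- The same series, moved across `X`, is a geometric series in `e - X * Y`. Thus one correction of
`Y` raises the errors on both sides to the `τ`-th power. -/
theorem mul_improve [DecidableEq I] {X : Matrix I J A} {Y : Matrix J I A} {e : Matrix I I A}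
    (he : e * e = e) (hX : e * X = X) (hY : Y * e = Y) (τ : ℕ) :
    X * improve X Y τ = e - (e - X * Y) ^ τ * e := by
  have h1 : ∀ t : ℕ, X * (1 - Y * X) ^ t = (e - X * Y) ^ t * X := by
    intro t
    induction t with
    | zero => simp
    | succ t ih =>
      rw [pow_succ, ← Matrix.mul_assoc, ih, pow_succ, Matrix.mul_assoc, Matrix.mul_assoc]
      congr 1
      rw [Matrix.mul_sub, Matrix.sub_mul, hX, Matrix.mul_one, Matrix.mul_assoc]
  have h2 : X * Y = (1 - (e - X * Y)) * e := by
    have : X * Y * e = X * Y := by rw [Matrix.mul_assoc, hY]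
    rw [sub_mul, sub_mul, this, one_mul, he]; abel
  rw [improve, ← Matrix.mul_assoc, Matrix.mul_sum, Finset.sum_congr rfl fun t _ => h1 t,
    ← Matrix.sum_mul, Matrix.mul_assoc]
  conv_lhs => rw [h2]
  rw [← Matrix.mul_assoc, ← h2, geom_sum_mul_neg, sub_mul, one_mul]

theorem improve_mul_right {X : Matrix I J A} {Y : Matrix J I A} {e : Matrix I I A}
    (hY : Y * e = Y) (τ : ℕ) : improve X Y τ * e = improve X Y τ := by
  rw [improve, Matrix.mul_assoc, hY]

end ApproximateInverse

/-! ### Lifting units along commuting retractions -/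

section UnitLift

/-- If commuting idempotent endomorphisms `e j` send `a` to units, then some unit has the same
images. -/
theorem exists_unit_lift {B ι : Type*} [Monoid B] [DecidableEq ι] (e : ι → B →* B)
    (comm : ∀ i j x, e i (e j x) = e j (e i x)) (idem : ∀ i x, e i (e i x) = e i x)
    (K : Finset ι) (a : B) (h : ∀ j ∈ K, IsUnit (e j a)) :
    ∃ u : Bˣ, ∀ j ∈ K, e j u = e j a := by
  induction K using Finset.induction_on with
  | empty => exact ⟨1, by simp⟩
  | insert k K hk ih =>
    obtain ⟨u, hu⟩ := ih fun j hj => h j (by simp [hj])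
    -- The correction factor `γ = e k (u⁻¹ * a)` repairs the image under `e k`. For the earlier `j`
    -- it is invisible, since `e j γ = e k (e j (u⁻¹ * a)) = 1`.
    have hγ : IsUnit (e k (↑u⁻¹ * a)) := by
      rw [map_mul]
      exact ((Units.isUnit _).map _).mul (h k (by simp))
    obtain ⟨γ, hγ⟩ := hγ
    refine ⟨u * γ, fun j hj => ?_⟩
    rw [Units.val_mul, hγ, map_mul]
    rcases Finset.mem_insert.1 hj with rfl | hj
    · rw [idem, ← map_mul, Units.mul_inv_cancel_left]
    · rw [comm, map_mul _ _ a, ← hu j hj, ← map_mul, Units.inv_mul, map_one, map_one, mul_one]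

end UnitLift

/-! ### Patching splittings along facets -/

section Patching

variable {R : Type*} [CommRing R] {L : Type*} [AddCommGroup L] {P : Type*} [AddCommGroup P]
variable {I J K : Type*} {ι : Type*} {l : ι → L →+ ℤ} {ψ : L →+ P}
  {w : I → P} {w' : J → P} {w'' : K → P}

theorem map_eps_mul [Fintype J] {Z₀ Z₁ : Finset ι} {M : Matrix I J (AddMonoidAlgebra R L)}
    {M' : Matrix J K (AddMonoidAlgebra R L)} (hM : M ∈ Gr R (face l Z₀) ψ w w')
    (hM' : M' ∈ Gr R (face l Z₁) ψ w' w'') (Z : Finset ι) :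
    (M * M').map (eps l Z) = M.map (eps l Z) * M'.map (eps l Z) := by
  ext1 i k
  rw [Matrix.map_apply, Matrix.mul_apply, Matrix.mul_apply, map_sum]
  refine Finset.sum_congr rfl fun j _ => ?_
  exact eps_mul ((hM i j).mono fun m hm => hm.1.1) ((hM' j k).mono fun m hm => hm.1.1)

theorem map_eps_of_mem {Z Z₀ : Finset ι} (hZ : Z ⊆ Z₀) {M : Matrix I J (AddMonoidAlgebra R L)}
    (hM : M ∈ Gr R (face l Z₀) ψ w w') : M.map (eps l Z) = M := by
  ext1 i j
  exact eps_eq_self ((hM i j).mono fun m hm k hk => hm.1.2 k (hZ hk))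

theorem map_eps_one [DecidableEq I] (Z : Finset ι) :
    (1 : Matrix I I (AddMonoidAlgebra R L)).map (eps l Z) = 1 :=
  Matrix.map_one _ (map_zero _) (eps_one Z)

theorem map_eps_add (Z : Finset ι) (M M' : Matrix I J (AddMonoidAlgebra R L)) :
    (M + M').map (eps l Z) = M.map (eps l Z) + M'.map (eps l Z) :=
  Matrix.map_add _ (map_add _) M M'

theorem map_eps_sub (Z : Finset ι) (M M' : Matrix I J (AddMonoidAlgebra R L)) :
    (M - M').map (eps l Z) = M.map (eps l Z) - M'.map (eps l Z) :=
  Matrix.map_sub _ (map_sub _) M M'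

/-- A graded matrix killed by all `eps {j}`, `j ∉ Z`, is supported in the interior. -/
theorem mem_interior_of_map_eps_eq_zero {Z : Finset ι} {M : Matrix I J (AddMonoidAlgebra R L)}
    (hM : M ∈ Gr R (face l Z) ψ w w') (h : ∀ j ∉ Z, M.map (eps l {j}) = 0) :
    M ∈ Gr R (interior l Z 1) ψ w w' := by
  intro i j m hm
  obtain ⟨h1, h2⟩ := hM i j m hm
  refine ⟨⟨h1, fun k hk => ?_⟩, h2⟩
  obtain ⟨k', hk', hne⟩ := suppIn_of_eps_eq_zero (congr_fun (congr_fun (h k hk) i) j) m hm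
  rw [Finset.mem_singleton] at hk'
  subst hk'
  have := h1.1 k'
  omega

theorem map_eps_eq_zero_of_mem_interior {Z : Finset ι} {M : Matrix I J (AddMonoidAlgebra R L)}
    (hM : M ∈ Gr R (interior l Z 1) ψ w w') {k : ι} (hk : k ∉ Z) : M.map (eps l {k}) = 0 := by
  ext1 i j
  refine eps_eq_zero ((hM i j).mono fun m hm => ⟨k, Finset.mem_singleton_self k, ?_⟩)
  have := hm.1.2 k hk
  omega

variable [DecidableEq ι]

theorem map_eps_mem {Z₀ : Finset ι} {M : Matrix I J (AddMonoidAlgebra R L)}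
    (hM : M ∈ Gr R (face l Z₀) ψ w w') (Z : Finset ι) :
    M.map (eps l Z) ∈ Gr R (face l (Z ∪ Z₀)) ψ w w' := by
  intro i j
  refine ((hM i j).eps Z).mono ?_
  rintro m ⟨⟨hm, hm'⟩, h⟩
  refine ⟨⟨hm.1, fun k hk => ?_⟩, hm'⟩
  rcases Finset.mem_union.1 hk with hk | hk
  exacts [h k hk, hm.2 k hk]

theorem map_eps_mem_insert {Z : Finset ι} {M : Matrix I J (AddMonoidAlgebra R L)}
    (hM : M ∈ Gr R (face l Z) ψ w w') (k : ι) :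
    M.map (eps l {k}) ∈ Gr R (face l (insert k Z)) ψ w w' := by
  rw [Finset.insert_eq]
  exact map_eps_mem hM {k}

theorem map_eps_mem_self {Z₀ : Finset ι} {M : Matrix I J (AddMonoidAlgebra R L)}
    (hM : M ∈ Gr R (face l Z₀) ψ w w') (Z : Finset ι) :
    M.map (eps l Z) ∈ Gr R (face l Z₀) ψ w w' :=
  Gr_mono (face_anti Finset.subset_union_right) (map_eps_mem hM Z)

theorem map_eps_map_eps (Z Z' : Finset ι) (M : Matrix I J (AddMonoidAlgebra R L)) :
    (M.map (eps l Z')).map (eps l Z) = M.map (eps l (Z ∪ Z')) := by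
  ext1 i j
  exact eps_eps Z Z' _

theorem map_eps_comm (Z Z' : Finset ι) (M : Matrix I J (AddMonoidAlgebra R L)) :
    (M.map (eps l Z')).map (eps l Z) = (M.map (eps l Z)).map (eps l Z') := by
  rw [map_eps_map_eps, map_eps_map_eps, Finset.union_comm]

/-- The endomorphism of the ring of square graded matrices induced by the projection onto a
face. -/
noncomputable def epsHom (R : Type*) [CommRing R] [Fintype I] [DecidableEq I] (l : ι → L →+ ℤ)
    (ψ : L →+ P) (w : I → P) (Z : Finset ι) (j : ι) :
    grRing R (face l Z) ψ w →* grRing R (face l Z) ψ w where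
  toFun M := ⟨M.1.map (eps l {j}), map_eps_mem_self M.2 {j}⟩
  map_one' := Subtype.ext (map_eps_one _)
  map_mul' M M' := Subtype.ext (map_eps_mul M.2 M'.2 {j})

theorem exists_unit_lift_Gr [Fintype I] [DecidableEq I] {Z : Finset ι} (S : Finset ι)
    {α : Matrix I I (AddMonoidAlgebra R L)} (hα : α ∈ Gr R (face l Z) ψ w w)
    (h : ∀ j ∈ S, ∃ β ∈ Gr R (face l Z) ψ w w,
      α.map (eps l {j}) * β = 1 ∧ β * α.map (eps l {j}) = 1) :
    ∃ u ∈ Gr R (face l Z) ψ w w, ∃ u' ∈ Gr R (face l Z) ψ w w, u * u' = 1 ∧ u' * u = 1 ∧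
      ∀ j ∈ S, u.map (eps l {j}) = α.map (eps l {j}) := by
  obtain ⟨u, hu⟩ := exists_unit_lift (epsHom R l ψ w Z)
    (fun i j x => Subtype.ext (map_eps_comm _ _ _))
    (fun i x => Subtype.ext (by
      change (x.1.map (eps l {i})).map (eps l {i}) = x.1.map (eps l {i})
      rw [map_eps_map_eps, Finset.union_idempotent])) S ⟨α, hα⟩ (by
      intro j hj
      obtain ⟨β, hβ, h1, h2⟩ := h j hj
      exact isUnit_iff_exists.2 ⟨⟨β, hβ⟩, Subtype.ext h1, Subtype.ext h2⟩)
  refine ⟨u.1.1, u.1.2, u⁻¹.1.1, u⁻¹.1.2, congr_arg Subtype.val u.mul_inv,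
    congr_arg Subtype.val u.inv_mul, fun j hj => congr_arg Subtype.val (hu j hj)⟩

/-- The graded idempotent matrix `e` over `R[S]` is isomorphic to a graded free module with
weights `p`. -/
def Splits [Fintype I] [Fintype J] [DecidableEq J] (S : AddSubmonoid L) (ψ : L →+ P) (q : I → P)
    (p : J → P) (e : Matrix I I (AddMonoidAlgebra R L)) : Prop :=
  ∃ X ∈ Gr R (S : Set L) ψ q p, ∃ Y ∈ Gr R (S : Set L) ψ p q, X * Y = e ∧ Y * X = 1

/-- Facets are added one at a time. On facets `j ∈ S`, the transition matrix `α = Y₁ * eps X`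
between the old data and the splitting `X₁`, `Y₁` on the facet `k` is invertible. A unit `u` with
the same images exists already over the facet `k`, so `X₁ * u` agrees with `X` on all overlaps. -/
theorem exists_splitting_on_faces [Fintype I] [Fintype J] [DecidableEq J] {q : I → P} {p : J → P}
    {Z : Finset ι} {e : Matrix I I (AddMonoidAlgebra R L)} (he : e ∈ Gr R (face l Z) ψ q q)
    (hee : e * e = e) (S : Finset ι)
    (h : ∀ k ∈ S, Splits (face l (insert k Z)) ψ q p (e.map (eps l {k}))) :
    ∃ X ∈ Gr R (face l Z) ψ q p, ∃ Y ∈ Gr R (face l Z) ψ p q, e * X = X ∧ Y * e = Y ∧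
      ∀ j ∈ S, X.map (eps l {j}) * Y.map (eps l {j}) = e.map (eps l {j}) ∧
        Y.map (eps l {j}) * X.map (eps l {j}) = 1 := by
  induction S using Finset.induction_on with
  | empty => exact ⟨0, zero_mem _, 0, zero_mem _, by simp, by simp, by simp⟩
  | insert k S hk ih =>
    obtain ⟨X, hX, Y, hY, heX, hYe, hXY⟩ := ih fun j hj => h j (by simp [hj])
    obtain ⟨X₁, hX₁, Y₁, hY₁, hXY₁, hYX₁⟩ := h k (by simp)
    have hsub : Z ⊆ insert k Z := Finset.subset_insert _ _
    have hks : {k} ⊆ insert k Z := by simp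
    have hX₁' := Gr_mono (face_anti hsub) hX₁
    have hY₁' := Gr_mono (face_anti hsub) hY₁
    have hαmem : Y₁ * X.map (eps l {k}) ∈ Gr R (face l (insert k Z)) ψ p p :=
      Gr_mul_mem hY₁ (map_eps_mem_insert hX k)
    have hα : ∀ j, (Y₁ * X.map (eps l {k})).map (eps l {j}) =
        Y₁.map (eps l {j}) * (X.map (eps l {j})).map (eps l {k}) := fun j => by
      rw [map_eps_mul hY₁' (map_eps_mem_self hX _), map_eps_comm]
    have hj1 : ∀ j, X₁.map (eps l {j}) * Y₁.map (eps l {j}) =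
        (e.map (eps l {j})).map (eps l {k}) := fun j => by
      rw [← map_eps_mul hX₁ hY₁, hXY₁, map_eps_comm]
    have hj2 : ∀ j, Y₁.map (eps l {j}) * X₁.map (eps l {j}) = 1 := fun j => by
      rw [← map_eps_mul hY₁ hX₁, hYX₁, map_eps_one]
    have hYe₁ : ∀ j, Y₁.map (eps l {j}) * (e.map (eps l {j})).map (eps l {k}) =
        Y₁.map (eps l {j}) := fun j => by
      rw [← hj1, ← Matrix.mul_assoc, hj2, Matrix.one_mul]
    have heX' : ∀ j, (e.map (eps l {j})).map (eps l {k}) * (X.map (eps l {j})).map (eps l {k}) =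
        (X.map (eps l {j})).map (eps l {k}) := fun j => by
      rw [← map_eps_mul (map_eps_mem_self he _) (map_eps_mem_self hX _), ← map_eps_mul he hX, heX]
    have hYe' : ∀ j, (Y.map (eps l {j})).map (eps l {k}) * (e.map (eps l {j})).map (eps l {k}) =
        (Y.map (eps l {j})).map (eps l {k}) := fun j => by
      rw [← map_eps_mul (map_eps_mem_self hY _) (map_eps_mem_self he _), ← map_eps_mul hY he, hYe]
    have hinv : ∀ j ∈ S,
        Y₁.map (eps l {j}) * (X.map (eps l {j})).map (eps l {k}) *
          ((Y.map (eps l {j})).map (eps l {k}) * X₁.map (eps l {j})) = 1 ∧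
        (Y.map (eps l {j})).map (eps l {k}) * X₁.map (eps l {j}) *
          (Y₁.map (eps l {j}) * (X.map (eps l {j})).map (eps l {k})) = 1 := by
      intro j hj
      obtain ⟨h1, h2⟩ := hXY j hj
      constructor
      · rw [Matrix.mul_assoc, ← Matrix.mul_assoc _ _ (X₁.map _),
          ← map_eps_mul (map_eps_mem_self hX _) (map_eps_mem_self hY _), h1,
          ← Matrix.mul_assoc, hYe₁, hj2]
      · rw [Matrix.mul_assoc, ← Matrix.mul_assoc (X₁.map _), hj1, heX',
          ← map_eps_mul (map_eps_mem_self hY _) (map_eps_mem_self hX _), h2, map_eps_one]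
    obtain ⟨u, hu, u', hu', huu', hu'u, huα⟩ := exists_unit_lift_Gr S hαmem fun j hj => by
      refine ⟨(Y.map (eps l {j})).map (eps l {k}) * X₁.map (eps l {j}),
        Gr_mul_mem (map_eps_mem_insert (map_eps_mem_self hY _) _) (map_eps_mem_self hX₁ _), ?_⟩
      rw [hα]
      exact hinv j hj
    have hG : X₁ * u ∈ Gr R (face l (insert k Z)) ψ q p := Gr_mul_mem hX₁ hu
    have hG' : u' * Y₁ ∈ Gr R (face l (insert k Z)) ψ p q := Gr_mul_mem hu' hY₁
    have hGZ := Gr_mono (face_anti hsub) hG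
    have hGZ' := Gr_mono (face_anti hsub) hG'
    have huu'j : ∀ j, u.map (eps l {j}) * u'.map (eps l {j}) = 1 := fun j => by
      rw [← map_eps_mul hu hu', huu', map_eps_one]
    have hGj : ∀ j ∈ S, (X₁ * u).map (eps l {j}) = (X.map (eps l {j})).map (eps l {k}) := by
      intro j hj
      rw [map_eps_mul hX₁ hu, huα j hj, hα, ← Matrix.mul_assoc, hj1, heX']
    have hGj' : ∀ j ∈ S, (u' * Y₁).map (eps l {j}) = (Y.map (eps l {j})).map (eps l {k}) := by
      intro j hj
      have hu'j : u'.map (eps l {j}) = (Y.map (eps l {j})).map (eps l {k}) * X₁.map (eps l {j}) := by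
        have h1 := (hinv j hj).2
        rw [← hα, ← huα j hj] at h1
        calc u'.map (eps l {j}) = ((Y.map (eps l {j})).map (eps l {k}) * X₁.map (eps l {j}) *
              u.map (eps l {j})) * u'.map (eps l {j}) := by rw [h1, Matrix.one_mul]
          _ = _ := by rw [Matrix.mul_assoc, huu'j, Matrix.mul_one]
      rw [map_eps_mul hu' hY₁, hu'j, Matrix.mul_assoc, hj1, hYe']
    have hGk : (X₁ * u).map (eps l {k}) = X₁ * u := map_eps_of_mem hks hG
    have hGk' : (u' * Y₁).map (eps l {k}) = u' * Y₁ := map_eps_of_mem hks hG'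
    have heG : e.map (eps l {k}) * (X₁ * u) = X₁ * u := by
      rw [← hXY₁, Matrix.mul_assoc, ← Matrix.mul_assoc Y₁, hYX₁, Matrix.one_mul]
    have hGe : u' * Y₁ * e.map (eps l {k}) = u' * Y₁ := by
      rw [← hXY₁, Matrix.mul_assoc, ← Matrix.mul_assoc Y₁, hYX₁, Matrix.one_mul]
    have hdX : X₁ * u - X.map (eps l {k}) ∈ Gr R (face l Z) ψ q p :=
      sub_mem hGZ (map_eps_mem_self hX _)
    have hdY : u' * Y₁ - Y.map (eps l {k}) ∈ Gr R (face l Z) ψ p q :=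
      sub_mem hGZ' (map_eps_mem_self hY _)
    -- Adding the discrepancy on the facet `k` changes `X` there to `X₁ * u`, and changes nothing on
    -- the facets `j ∈ S`, where the discrepancy vanishes. The factor `e` keeps the columns in the
    -- image of `e`.
    have hXj : ∀ j ∈ S, (X + e * (X₁ * u - X.map (eps l {k}))).map (eps l {j}) =
        X.map (eps l {j}) := by
      intro j hj
      rw [map_eps_add, map_eps_mul he hdX, map_eps_sub, hGj j hj, map_eps_comm, sub_self,
        Matrix.mul_zero, add_zero]
    have hYj : ∀ j ∈ S, (Y + (u' * Y₁ - Y.map (eps l {k})) * e).map (eps l {j}) =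
        Y.map (eps l {j}) := by
      intro j hj
      rw [map_eps_add, map_eps_mul hdY he, map_eps_sub, hGj' j hj, map_eps_comm, sub_self,
        Matrix.zero_mul, add_zero]
    have hXk : (X + e * (X₁ * u - X.map (eps l {k}))).map (eps l {k}) = X₁ * u := by
      rw [map_eps_add, map_eps_mul he hdX, map_eps_sub, hGk, map_eps_map_eps,
        Finset.union_idempotent, Matrix.mul_sub, heG, ← map_eps_mul he hX, heX]
      abel
    have hYk : (Y + (u' * Y₁ - Y.map (eps l {k})) * e).map (eps l {k}) = u' * Y₁ := by
      rw [map_eps_add, map_eps_mul hdY he, map_eps_sub, hGk', map_eps_map_eps,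
        Finset.union_idempotent, Matrix.sub_mul, hGe, ← map_eps_mul hY he, hYe]
      abel
    refine ⟨X + e * (X₁ * u - X.map (eps l {k})), add_mem hX (Gr_mul_mem he hdX),
      Y + (u' * Y₁ - Y.map (eps l {k})) * e, add_mem hY (Gr_mul_mem hdY he), ?_, ?_, ?_⟩
    · rw [Matrix.mul_add, ← Matrix.mul_assoc, hee, heX]
    · rw [Matrix.add_mul, Matrix.mul_assoc, hee, hYe]
    · intro j hj
      rcases Finset.mem_insert.1 hj with rfl | hj
      · rw [hXk, hYk, Matrix.mul_assoc, ← Matrix.mul_assoc u, huu', Matrix.one_mul, hXY₁,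
          Matrix.mul_assoc, ← Matrix.mul_assoc Y₁, hYX₁, Matrix.one_mul, hu'u]
        exact ⟨rfl, rfl⟩
      · rw [hXj j hj, hYj j hj]
        exact hXY j hj

end Patching

/-! ### Elementary reduction to diagonal form, and absence of poles -/

section Elementary

variable {R : Type*} [CommRing R] {L : Type*} [AddCommGroup L] {P : Type*} [AddCommGroup P]
variable {I J : Type*} [Fintype I] {ι : Type*} {l : ι → L →+ ℤ} {ψ : L →+ P}
  {w : I → P} {w' : J → P}

theorem Gr_interior_mul {K : Type*} {w'' : K → P} {Z : Finset ι} {t t' : ℤ}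
    {M : Matrix J I (AddMonoidAlgebra R L)} {M' : Matrix I K (AddMonoidAlgebra R L)}
    (hM : M ∈ Gr R (interior l Z t) ψ w' w) (hM' : M' ∈ Gr R (interior l Z t') ψ w w'') :
    M * M' ∈ Gr R (interior l Z (t + t')) ψ w' w'' :=
  Gr_mul hM hM' fun _ ha _ hb => interior_add ha hb

theorem Gr_face_mul_interior {K : Type*} {w'' : K → P} {Z : Finset ι} {t : ℤ}
    {M : Matrix J I (AddMonoidAlgebra R L)} {M' : Matrix I K (AddMonoidAlgebra R L)}
    (hM : M ∈ Gr R (face l Z) ψ w' w) (hM' : M' ∈ Gr R (interior l Z t) ψ w w'') :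
    M * M' ∈ Gr R (interior l Z t) ψ w' w'' :=
  Gr_mul hM hM' fun _ ha _ hb => face_add_interior ha hb

theorem Gr_interior_mul_face {K : Type*} {w'' : K → P} {Z : Finset ι} {t : ℤ}
    {M : Matrix J I (AddMonoidAlgebra R L)} {M' : Matrix I K (AddMonoidAlgebra R L)}
    (hM : M ∈ Gr R (interior l Z t) ψ w' w) (hM' : M' ∈ Gr R (face l Z) ψ w w'') :
    M * M' ∈ Gr R (interior l Z t) ψ w' w'' :=
  Gr_mul hM hM' fun _ ha _ hb => by rw [add_comm]; exact face_add_interior hb ha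

variable [DecidableEq I]

/-- A product of transvections `1 - s` equals one minus the sum of the `s` up to products of at
least two factors. These have depth at least `2 * t ≥ t + 1`. -/
theorem exists_prod_transvections {Z : Finset ι} {t : ℤ} (ht : 1 ≤ t)
    {O : Matrix I I (AddMonoidAlgebra R L)} (hO : O ∈ Gr R (interior l Z t) ψ w w)
    (F : Finset (I × I)) (hF : ∀ x ∈ F, x.1 ≠ x.2) :
    ∃ u ∈ Gr R (face l Z) ψ w w, ∃ u' ∈ Gr R (face l Z) ψ w w, u * u' = 1 ∧ u' * u = 1 ∧
      u - (1 - ∑ x ∈ F, Matrix.single x.1 x.2 (O x.1 x.2)) ∈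
        Gr R (interior l Z (t + 1)) ψ w w := by
  induction F using Finset.induction_on with
  | empty =>
    have h1 : (1 : Matrix I I (AddMonoidAlgebra R L)) ∈ Gr R (face l Z) ψ w w :=
      one_mem_Gr (zero_mem _)
    exact ⟨1, h1, 1, h1, by simp, by simp, by simp⟩
  | insert x F hx ih =>
    obtain ⟨u, hu, u', hu', huu', hu'u, hd⟩ := ih fun y hy => hF y (by simp [hy])
    set s := Matrix.single x.1 x.2 (O x.1 x.2) with hs
    set T := ∑ x ∈ F, Matrix.single x.1 x.2 (O x.1 x.2) with hT
    have hsmem : s ∈ Gr R (interior l Z t) ψ w w := single_mem_Gr hO _ _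
    have hTmem : T ∈ Gr R (interior l Z t) ψ w w := sum_mem fun y _ => single_mem_Gr hO _ _
    have hsface := Gr_mono (interior_subset Z t) hsmem
    have h1 : (1 : Matrix I I (AddMonoidAlgebra R L)) ∈ Gr R (face l Z) ψ w w :=
      one_mem_Gr (zero_mem _)
    have hss : s * s = 0 := by
      rw [hs, Matrix.single_mul_single_of_ne]
      exact (hF x (by simp)).symm
    refine ⟨(1 - s) * u, Gr_mul_mem (sub_mem h1 hsface) hu, u' * (1 + s),
      Gr_mul_mem hu' (add_mem h1 hsface), ?_, ?_, ?_⟩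
    · calc (1 - s) * u * (u' * (1 + s)) = (1 - s) * (u * u') * (1 + s) := by noncomm_ring
        _ = 1 - s * s := by rw [huu']; noncomm_ring
        _ = 1 := by rw [hss, sub_zero]
    · calc u' * (1 + s) * ((1 - s) * u) = u' * (1 - s * s) * u := by noncomm_ring
        _ = 1 := by rw [hss, sub_zero, mul_one, hu'u]
    · rw [Finset.sum_insert hx, ← hT, ← hs]
      have : (1 - s) * u - (1 - (s + T)) = (1 - s) * (u - (1 - T)) + s * T := by noncomm_ring
      rw [this]
      exact add_mem (Gr_face_mul_interior (sub_mem h1 hsface) hd)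
        (Gr_mono (interior_anti Z (by omega)) (Gr_interior_mul hsmem hTmem))

theorem sum_single_offDiag {A : Type*} [CommRing A] (O : Matrix I I A) :
    ∑ x ∈ Finset.univ.filter (fun x : I × I => x.1 ≠ x.2), Matrix.single x.1 x.2 (O x.1 x.2) =
      O - Matrix.diagonal fun i => O i i := by
  ext1 i j
  rw [Matrix.sum_apply, Finset.sum_filter, Finset.sum_eq_single (i, j)]
  · by_cases hij : i = j
    · subst hij; simp
    · simp [hij]
  · rintro ⟨a, b⟩ - hab
    split_ifs with h
    · rw [Matrix.single_apply, if_neg]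
      rintro ⟨rfl, rfl⟩
      exact hab rfl
    · rfl
  · simp

/-- A graded matrix that is `1` up to the interior is a graded invertible matrix times a diagonal
one, up to any prescribed depth. -/
theorem exists_mul_eq_diagonal_add {Z : Finset ι} {C : Matrix I I (AddMonoidAlgebra R L)}
    (hC : C - 1 ∈ Gr R (interior l Z 1) ψ w w) (t : ℕ) :
    ∃ u ∈ Gr R (face l Z) ψ w w, ∃ u' ∈ Gr R (face l Z) ψ w w, u * u' = 1 ∧ u' * u = 1 ∧
      ∃ d : I → AddMonoidAlgebra R L,
        Matrix.diagonal d - 1 ∈ Gr R (interior l Z 1) ψ w w ∧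
        u * C - Matrix.diagonal d ∈ Gr R (interior l Z (t + 1)) ψ w w := by
  have h1 : (1 : Matrix I I (AddMonoidAlgebra R L)) ∈ Gr R (face l Z) ψ w w :=
    one_mem_Gr (zero_mem _)
  have hCf : C ∈ Gr R (face l Z) ψ w w := by
    have := add_mem (Gr_mono (interior_subset Z 1) hC) h1
    rwa [sub_add_cancel] at this
  induction t with
  | zero =>
    refine ⟨1, h1, 1, h1, by simp, by simp, 1, ?_, ?_⟩
    · rw [show (1 : I → AddMonoidAlgebra R L) = fun _ => 1 from rfl, Matrix.diagonal_one, sub_self]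
      exact zero_mem _
    · rw [show (1 : I → AddMonoidAlgebra R L) = fun _ => 1 from rfl, Matrix.diagonal_one, one_mul]
      simpa using hC
  | succ t ih =>
    obtain ⟨u, hu, u', hu', huu', hu'u, d, hd, hO⟩ := ih
    set O := u * C - Matrix.diagonal d with hOdef
    obtain ⟨v, hv, v', hv', hvv', hv'v, hvO⟩ := exists_prod_transvections (by omega) hO
      (Finset.univ.filter fun x : I × I => x.1 ≠ x.2) (by simp)
    rw [sum_single_offDiag] at hvO
    have hOd := diagonal_mem_Gr hO
    set Od := Matrix.diagonal fun i => O i i with hOd_def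
    have hsum : Matrix.diagonal (d + fun i => O i i) = Matrix.diagonal d + Od := by
      rw [hOd_def, Matrix.diagonal_add]; rfl
    have hd' : Matrix.diagonal (d + fun i => O i i) - 1 ∈ Gr R (interior l Z 1) ψ w w := by
      rw [hsum, add_sub_right_comm]
      exact add_mem hd (Gr_mono (interior_anti Z (by omega)) hOd)
    refine ⟨v * u, Gr_mul_mem hv hu, u' * v', Gr_mul_mem hu' hv', ?_, ?_, d + fun i => O i i,
      hd', ?_⟩
    · rw [mul_assoc, ← mul_assoc u, huu', one_mul, hvv']
    · rw [mul_assoc, ← mul_assoc v', hv'v, one_mul, hu'u]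
    · rw [hsum] at hd' ⊢
      -- The cross terms are arranged so that each has depth at least `t + 2`: the first by the
      -- choice of `v`, the second because the diagonal is `1` up to depth one, the third because
      -- `O` occurs twice.
      have key : v * u * C - (Matrix.diagonal d + Od) =
          (v - (1 - (O - Od))) * (u * C) - (O - Od) * (Matrix.diagonal d + Od - 1)
            - (O - Od) * (O - Od) := by
        have : u * C = O + Matrix.diagonal d := by rw [hOdef, sub_add_cancel]
        rw [mul_assoc, this]
        noncomm_ring
      rw [key]
      have hOo := sub_mem hO hOd
      push_cast
      exact sub_mem (sub_mem (Gr_interior_mul_face hvO (Gr_mul_mem hu hCf))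
        (Gr_interior_mul hOo hd')) (Gr_mono (interior_anti Z (by omega)) (Gr_interior_mul hOo hOo))

theorem exists_bound [Finite ι] (l : ι → L →+ ℤ) (B : Set L) (hB : B.Finite) :
    ∃ τ : ℕ, ∀ m ∈ B, ∀ k, |l k m| ≤ τ := by
  classical
  have := Fintype.ofFinite ι
  refine ⟨∑ m ∈ hB.toFinset, ∑ k, (l k m).natAbs, fun m hm k => ?_⟩
  rw [Int.abs_eq_natAbs]
  have h1 : (l k m).natAbs ≤ ∑ k, (l k m).natAbs :=
    Finset.single_le_sum (f := fun k => (l k m).natAbs) (fun _ _ => Nat.zero_le _)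
      (Finset.mem_univ k)
  have h2 : ∑ k, (l k m).natAbs ≤ ∑ m ∈ hB.toFinset, ∑ k, (l k m).natAbs :=
    Finset.single_le_sum (f := fun m => ∑ k, (l k m).natAbs) (fun _ _ => Nat.zero_le _)
      (hB.mem_toFinset.2 hm)
  exact_mod_cast h1.trans h2

/-- A graded Laurent matrix that becomes integral after multiplication with a matrix congruent
to `1` is integral. -/
theorem mem_face_of_mul_mem [Finite ι] [Finite J] {Z : Finset ι}
    {M : Matrix J I (AddMonoidAlgebra R L)} {K : Matrix I I (AddMonoidAlgebra R L)}
    (hM : M ∈ Gr R (lineal l Z) ψ w' w) (hK : K ∈ Gr R (interior l Z 1) ψ w w)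
    (h : M * (1 + K) ∈ Gr R (face l Z) ψ w' w) : M ∈ Gr R (face l Z) ψ w' w := by
  obtain ⟨τ, hτ⟩ := exists_bound l (⋃ i, ⋃ j, ((M i j).coeff.support : Set L))
    (Set.finite_iUnion fun _ => Set.finite_iUnion fun _ => Finset.finite_toSet _)
  have hM' : M ∈ Gr R {m | m ∈ lineal l Z ∧ ∀ k, -(τ : ℤ) ≤ l k m} ψ w' w := by
    intro i j m hm
    refine ⟨⟨(hM i j m hm).1, fun k => ?_⟩, (hM i j m hm).2⟩
    refine (abs_le.1 (hτ m ?_ k)).1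
    simp only [Set.mem_iUnion]
    exact ⟨i, j, Finsupp.mem_support_iff.2 hm⟩
  have hKn := neg_mem hK
  -- The first term is integral by hypothesis. In the second, `τ` factors of positive depth absorb
  -- the poles of `M`, whose order is at most `τ`.
  have key : M = M * (1 + K) * ∑ t ∈ Finset.range τ, (-K) ^ t + M * (-K) ^ τ := by
    have := mul_neg_geom_sum (-K) τ
    rw [sub_neg_eq_add] at this
    rw [Matrix.mul_assoc, this, Matrix.mul_sub, Matrix.mul_one, sub_add_cancel]
  rw [key]
  refine add_mem (Gr_mul_mem h (sum_mem fun t _ => ?_)) (Gr_mul hM' (pow_mem_interior hKn τ) ?_)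
  · exact Gr_mono (interior_subset _ _) (pow_mem_interior hKn t)
  · rintro a ⟨ha, ha'⟩ b ⟨hb, hb'⟩
    refine ⟨fun k => ?_, fun k hk => ?_⟩
    · by_cases hk : k ∈ Z
      · rw [map_add, ha k hk, hb.2 k hk, add_zero]
      · rw [map_add]; linarith [ha' k, hb' k hk]
    · rw [map_add, ha k hk, hb.2 k hk, add_zero]

end Elementary

/-! ### Rescaling rows and columns by monomials -/

section Shift

variable {R : Type*} [CommRing R] {L : Type*} [AddCommGroup L] {P : Type*} [AddCommGroup P]
variable {I J K : Type*}

/-- Multiplication of the `(i, j)` entry by the monomial `c + b i - b' j`. -/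
noncomputable def shift (c : L) (b : I → L) (b' : J → L) :
    Matrix I J (AddMonoidAlgebra R L) →+ Matrix I J (AddMonoidAlgebra R L) where
  toFun M := Matrix.of fun i j => single (c + b i - b' j) 1 * M i j
  map_zero' := by ext1 i j; simp
  map_add' M M' := by ext1 i j; simp [mul_add]

theorem shift_apply (c : L) (b : I → L) (b' : J → L) (M : Matrix I J (AddMonoidAlgebra R L))
    (i : I) (j : J) : shift c b b' M i j = single (c + b i - b' j) 1 * M i j := rfl

theorem shift_mul_shift [Fintype J] (c c' : L) (b : I → L) (b' : J → L) (b'' : K → L)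
    (M : Matrix I J (AddMonoidAlgebra R L)) (M' : Matrix J K (AddMonoidAlgebra R L)) :
    shift c b b' M * shift c' b' b'' M' = shift (c + c') b b'' (M * M') := by
  ext1 i k
  rw [shift_apply, Matrix.mul_apply, Matrix.mul_apply, Finset.mul_sum]
  refine Finset.sum_congr rfl fun j _ => ?_
  rw [shift_apply, shift_apply, mul_mul_mul_comm, single_mul_single, one_mul]
  congr 2
  abel

/-- The row and column monomials cancel on the diagonal. This is what makes reduction to diagonal
form useful: away from the diagonal, undoing a rescaling costs depth. -/
theorem shift_diagonal [DecidableEq I] (b : I → L) (d : I → AddMonoidAlgebra R L) :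
    shift 0 b b (Matrix.diagonal d) = Matrix.diagonal d := by
  ext1 i j
  rw [shift_apply, Matrix.diagonal_apply]
  split_ifs with h
  · subst h
    rw [zero_add, sub_self, ← one_def, one_mul]
  · rw [mul_zero]

theorem shift_one [DecidableEq I] (b : I → L) :
    shift 0 b b (1 : Matrix I I (AddMonoidAlgebra R L)) = 1 := by
  rw [← Matrix.diagonal_one, shift_diagonal]

theorem shift_neg_shift (b : I → L) (b' : J → L) (M : Matrix I J (AddMonoidAlgebra R L)) :
    shift 0 (-b) (-b') (shift 0 b b' M) = M := by
  ext1 i j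
  rw [shift_apply, shift_apply, ← mul_assoc, single_mul_single, one_mul]
  rw [show (0 + (-b) i - (-b') j + (0 + b i - b' j) : L) = 0 by simp, ← one_def, one_mul]

theorem shift_mem {ψ : L →+ P} {w v : I → P} {w' v' : J → P} {D D' : Set L} {c : L} {b : I → L}
    {b' : J → L} {M : Matrix I J (AddMonoidAlgebra R L)} (hM : M ∈ Gr R D ψ w w')
    (hD : ∀ i j, ∀ m ∈ D, c + b i - b' j + m ∈ D') (hc : ψ c = 0)
    (hb : ∀ i, ψ (b i) = w i - v i) (hb' : ∀ j, ψ (b' j) = w' j - v' j) :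
    shift c b b' M ∈ Gr R D' ψ v v' := by
  intro i j
  refine SuppIn.mul (suppIn_single (Set.mem_singleton _) 1) (hM i j) ?_
  rintro a rfl m ⟨hm, hm'⟩
  refine ⟨hD i j m hm, ?_⟩
  rw [map_add, map_sub, map_add, hc, hb, hb', hm']
  abel

end Shift

/-! ### Splitting block by block over the invariants -/

section BlockSplit

variable {R : Type*} [CommRing R] {L : Type*} [AddCommGroup L] {P : Type*} [AddCommGroup P]
variable {ψ : L →+ P}

variable (R) in
/-- Idempotent matrices over the ring of invariants `R[S]_0` have free images. -/
def InvariantsSplit (S : AddSubmonoid L) (ψ : L →+ P) : Prop :=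
  ∀ (n : ℕ) (e : Matrix (Fin n) (Fin n) (AddMonoidAlgebra R L)),
    e ∈ Gr R (S : Set L) ψ (0 : Fin n → P) 0 → e * e = e → ∃ m : ℕ,
      Splits S ψ (0 : Fin n → P) (0 : Fin m → P) e

theorem InvariantsSplit.of_fintype {S : AddSubmonoid L} (h : InvariantsSplit R S ψ)
    {I : Type*} [Fintype I] {e : Matrix I I (AddMonoidAlgebra R L)}
    (he : e ∈ Gr R (S : Set L) ψ (0 : I → P) 0) (hee : e * e = e) :
    ∃ m : ℕ, Splits S ψ (0 : I → P) (0 : Fin m → P) e := by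
  let φ := Fintype.equivFin I
  obtain ⟨m, X, hX, Y, hY, hXY, hYX⟩ := h _ (e.submatrix φ.symm φ.symm)
    (fun i j => he _ _) (by rw [Matrix.submatrix_mul_equiv, hee])
  refine ⟨m, X.submatrix φ id, fun i j => hX _ _, Y.submatrix id φ, fun i j => hY _ _, ?_, ?_⟩
  · rw [← Matrix.submatrix_mul _ _ _ id _ Function.bijective_id, hXY, Matrix.submatrix_submatrix]
    simp
  · rw [Matrix.submatrix_mul_equiv, hYX, Matrix.submatrix_id_id]

/-- Under `hw`, entries between different weights vanish, so `e` commutes with the projector `D c`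
onto each weight. The entries of `D c * e` have degree `0`, and the splittings of these idempotents
over the invariants assemble to one of `e`. -/
theorem InvariantsSplit.splits {S : AddSubmonoid L} (h : InvariantsSplit R S ψ)
    {I : Type*} [Fintype I] {w : I → P} {e : Matrix I I (AddMonoidAlgebra R L)}
    (he : e ∈ Gr R (S : Set L) ψ w w) (hee : e * e = e)
    (hw : ∀ m ∈ S, ∀ i j, ψ m = w j - w i → w i = w j) :
    ∃ (V : Type) (_ : Fintype V) (_ : DecidableEq V) (wV : V → P),
      (∀ v, ∃ i, w i = wV v) ∧ Splits S ψ w wV e := by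
  classical
  obtain ⟨n, g, hg, hgw, hgw'⟩ : ∃ (n : ℕ) (g : Fin n → P), Function.Injective g ∧
      (∀ i, ∃ c, g c = w i) ∧ ∀ c, ∃ i, w i = g c := by
    refine ⟨_, fun c => ((Finset.univ.image w).equivFin.symm c : P),
      fun a b hab => (Finset.equivFin _).symm.injective (Subtype.ext hab), fun i => ?_,
      fun c => ?_⟩
    · exact ⟨(Finset.univ.image w).equivFin ⟨w i, by simp⟩, by simp⟩
    · obtain ⟨i, -, hi⟩ := Finset.mem_image.1 ((Finset.univ.image w).equivFin.symm c).2
      exact ⟨i, hi⟩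
  have hzero : ∀ i j, w i ≠ w j → e i j = 0 := fun i j hij =>
    SuppIn.eq_zero ((he i j).mono fun m hm => hij (hw m hm.1 i j hm.2))
  let D : Fin n → Matrix I I (AddMonoidAlgebra R L) :=
    fun c => Matrix.diagonal fun i => if w i = g c then 1 else 0
  have hDe : ∀ c, D c * e = e * D c := by
    intro c
    ext1 i j
    rw [Matrix.diagonal_mul, Matrix.mul_diagonal]
    by_cases hij : w i = w j
    · rw [hij, mul_comm]
    · rw [hzero i j hij, mul_zero, zero_mul]
  have hDD : ∀ c, D c * D c = D c := by
    intro c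
    rw [Matrix.diagonal_mul_diagonal]
    congr 1; ext1 i
    split_ifs <;> simp
  have hDD' : ∀ c c', c ≠ c' → D c * D c' = 0 := by
    intro c c' hc
    rw [Matrix.diagonal_mul_diagonal, ← Matrix.diagonal_zero]
    congr 1; ext1 i
    split_ifs with h1 h2 <;> simp
    exact (hc (hg (h1.symm.trans h2))).elim
  have hDsum : ∑ c, D c = 1 := by
    ext1 i j
    rw [Matrix.sum_apply]
    by_cases hij : i = j
    · subst hij
      obtain ⟨c, hc⟩ := hgw i
      rw [Finset.sum_eq_single c]
      · simp [D, hc]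
      · intro b _ hb
        simp only [D, Matrix.diagonal_apply_eq]
        rw [if_neg]
        rw [← hc]
        exact fun h => hb (hg h.symm)
      · simp
    · simp [D, hij]
  have hec : ∀ c, D c * e ∈ Gr R (S : Set L) ψ (0 : I → P) 0 := by
    intro c i j
    rw [Matrix.diagonal_mul]
    by_cases hij : w i = w j
    · split_ifs
      · rw [one_mul]
        refine (he i j).mono fun m hm => ⟨hm.1, ?_⟩
        rw [hm.2, hij]; simp
      · rw [zero_mul]; exact suppIn_zero _
    · rw [hzero i j hij, mul_zero]; exact suppIn_zero _
  have hece : ∀ c, D c * e * (D c * e) = D c * e := by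
    intro c
    rw [Matrix.mul_assoc, ← Matrix.mul_assoc e, ← hDe, Matrix.mul_assoc, hee, ← Matrix.mul_assoc,
      hDD]
  choose m X hX Y hY hXY hYX using fun c => h.of_fintype (hec c) (hece c)
  have hDX : ∀ c, D c * X c = X c := fun c => by
    calc D c * X c = D c * (X c * (Y c * X c)) := by rw [hYX, Matrix.mul_one]
      _ = D c * D c * e * X c := by rw [← Matrix.mul_assoc (X c), hXY]; simp only [Matrix.mul_assoc]
      _ = X c * (Y c * X c) := by rw [hDD, ← hXY, Matrix.mul_assoc]
      _ = X c := by rw [hYX, Matrix.mul_one]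
  have hYD : ∀ c, Y c * D c = Y c := fun c => by
    calc Y c * D c = (Y c * X c) * Y c * D c := by rw [hYX, Matrix.one_mul]
      _ = Y c * (D c * e * D c) := by rw [← hXY]; simp only [Matrix.mul_assoc]
      _ = Y c * (X c * Y c) := by rw [hXY, Matrix.mul_assoc (D c), ← hDe, ← Matrix.mul_assoc (D c), hDD]
      _ = Y c := by rw [← Matrix.mul_assoc, hYX, Matrix.one_mul]
  have hXw : ∀ c i v, X c i v ≠ 0 → w i = g c := by
    intro c i v hne
    rw [← hDX, Matrix.diagonal_mul] at hne
    by_contra hcon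
    rw [if_neg hcon, zero_mul] at hne
    exact hne rfl
  have hYw : ∀ c v i, Y c v i ≠ 0 → w i = g c := by
    intro c v i hne
    rw [← hYD, Matrix.mul_diagonal] at hne
    by_contra hcon
    rw [if_neg hcon, mul_zero] at hne
    exact hne rfl
  refine ⟨Σ c, Fin (m c), inferInstance, inferInstance, fun x => g x.1,
    fun x => hgw' x.1, Matrix.of fun i x => X x.1 i x.2, ?_, Matrix.of fun x i => Y x.1 x.2 i, ?_, ?_, ?_⟩
  · intro i x k hk
    have := hX x.1 i x.2 k hk
    refine ⟨this.1, ?_⟩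
    rw [hXw x.1 i x.2 (fun h0 => hk (by simp [h0])), this.2]
    simp
  · intro x i k hk
    have := hY x.1 x.2 i k hk
    refine ⟨this.1, ?_⟩
    rw [hYw x.1 x.2 i (fun h0 => hk (by simp [h0])), this.2]
    simp
  · calc _ = ∑ c, X c * Y c := by
          ext1 i j
          rw [Matrix.mul_apply, Fintype.sum_sigma, Matrix.sum_apply]
          rfl
      _ = e := by rw [Finset.sum_congr rfl fun c _ => hXY c, ← Matrix.sum_mul, hDsum, Matrix.one_mul]
  · ext1 ⟨c, v⟩ ⟨c', v'⟩
    have h1 : (Matrix.of (fun (x : Σ c, Fin (m c)) i => Y x.1 x.2 i) *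
        Matrix.of fun i (x : Σ c, Fin (m c)) => X x.1 i x.2) ⟨c, v⟩ ⟨c', v'⟩ = (Y c * X c') v v' := by
      rw [Matrix.mul_apply, Matrix.mul_apply]; rfl
    rw [h1]
    by_cases hc : c = c'
    · subst hc
      rw [hYX, Matrix.one_apply, Matrix.one_apply]
      simp
    · rw [← hYD, ← hDX, Matrix.mul_assoc, ← Matrix.mul_assoc (D c), hDD' c c' hc, Matrix.zero_mul,
        Matrix.mul_zero, Matrix.one_apply, if_neg]
      · rfl
      · intro h0; exact hc (congr_arg Sigma.fst h0)

end BlockSplit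

/-! ### Normalizing weights modulo the image of a subgroup -/

section Cosets

variable {L : Type*} [AddCommGroup L] {P : Type*} [AddCommGroup P]

/-- Here `r` picks a representative modulo `ψ(Q)`. Rescaling by the monomials `a x` replaces the
weight `x` by `r x`, after which two weights differing by an element of `ψ(Q)` are equal, as
`InvariantsSplit.splits` requires. -/
theorem exists_coset_representatives (ψ : L →+ P) (Q : AddSubgroup L) :
    ∃ (a : P → L) (r : P → P), (∀ x, a x ∈ Q) ∧ (∀ x, ψ (a x) = x - r x) ∧
      ∀ x y, ∀ m ∈ Q, ψ m = y - x → r x = r y := by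
  let r : P → P := fun x => (QuotientAddGroup.mk x : P ⧸ Q.map ψ).out
  have hr : ∀ x, x - r x ∈ Q.map ψ := by
    intro x
    rw [sub_eq_neg_add, ← QuotientAddGroup.eq]
    exact Quotient.out_eq' _
  choose a ha hax using hr
  refine ⟨a, r, ha, hax, fun x y m hm hxy => ?_⟩
  have : (QuotientAddGroup.mk x : P ⧸ Q.map ψ) = QuotientAddGroup.mk y := by
    rw [QuotientAddGroup.eq, ← sub_eq_neg_add, ← hxy]
    exact ⟨m, hm, rfl⟩
  simp only [r, this]

end Cosets

/-! ### Comparison of weights -/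

section Rank

theorem sum_fiber {A T P : Type*} [AddCommMonoid A] [Fintype T] (u : T → P) (x : P)
    [Fintype {t // u t = x}] (f : T → A) (hf : ∀ t, f t ≠ 0 → u t = x) :
    ∑ t : {t // u t = x}, f t = ∑ t, f t := by
  classical
  rw [← Finset.sum_subtype (Finset.univ.filter fun t => u t = x) (by simp) f]
  exact Finset.sum_filter_of_ne fun t _ ht => hf t ht

/-- Mutually inverse matrices that respect weights are inverse block by block, and over a nontrivial
commutative ring an invertible matrix is square. -/
theorem exists_equiv_of_mul_eq_one {A : Type*} [CommRing A] [Nontrivial A] {V J P : Type*}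
    [Fintype V] [Fintype J] [DecidableEq V] [DecidableEq J] {wV : V → P} {w : J → P}
    {C : Matrix V J A} {D : Matrix J V A} (hCD : C * D = 1) (hDC : D * C = 1)
    (hC : ∀ v j, C v j ≠ 0 → wV v = w j) (hD : ∀ j v, D j v ≠ 0 → wV v = w j) :
    ∃ φ : V ≃ J, ∀ v, w (φ v) = wV v := by
  classical
  have key : ∀ x, Nonempty ({v // wV v = x} ≃ {j // w j = x}) := by
    intro x
    rw [← Fintype.card_eq]
    refine Matrix.square_of_invertible (R := A) (C.submatrix Subtype.val Subtype.val)
      (D.submatrix Subtype.val Subtype.val) ?_ ?_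
    · ext1 v v'
      rw [Matrix.mul_apply]
      simp only [Matrix.submatrix_apply]
      rw [sum_fiber w x (fun j => C v j * D j v') fun j hj => by
        rw [← hC _ _ (left_ne_zero_of_mul hj), v.2], ← Matrix.mul_apply, hCD]
      simp [Matrix.one_apply, Subtype.ext_iff]
    · ext1 j j'
      rw [Matrix.mul_apply]
      simp only [Matrix.submatrix_apply]
      rw [sum_fiber wV x (fun v => D j v * C v j') fun v hv => by
        rw [hD _ _ (left_ne_zero_of_mul hv), j.2], ← Matrix.mul_apply, hDC]
      simp [Matrix.one_apply, Subtype.ext_iff]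
  exact ⟨Equiv.ofFiberEquiv fun x => (key x).some, fun v => Equiv.ofFiberEquiv_map _ v⟩

end Rank

/-! ### Block and reindexed graded matrices -/

section Blocks

variable {R : Type*} [CommRing R] {L : Type*} [AddCommGroup L] {P : Type*} [AddCommGroup P]
variable {I J K M : Type*} {ψ : L →+ P} {D : Set L} {w : I → P} {w' : J → P} {v : K → P}
  {v' : M → P}

theorem fromRows_mem_Gr {A : Matrix I K (AddMonoidAlgebra R L)}
    {B : Matrix J K (AddMonoidAlgebra R L)} (hA : A ∈ Gr R D ψ w v) (hB : B ∈ Gr R D ψ w' v) :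
    Matrix.fromRows A B ∈ Gr R D ψ (Sum.elim w w') v := by
  rintro (i | i) k
  exacts [hA i k, hB i k]

theorem fromCols_mem_Gr {A : Matrix K I (AddMonoidAlgebra R L)}
    {B : Matrix K J (AddMonoidAlgebra R L)} (hA : A ∈ Gr R D ψ v w) (hB : B ∈ Gr R D ψ v w') :
    Matrix.fromCols A B ∈ Gr R D ψ v (Sum.elim w w') := by
  rintro k (i | i)
  exacts [hA k i, hB k i]

theorem submatrix_id_mem_Gr {A : Matrix I J (AddMonoidAlgebra R L)} (hA : A ∈ Gr R D ψ w w')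
    {f : K → J} (hf : ∀ k, w' (f k) = v k) : A.submatrix id f ∈ Gr R D ψ w v := by
  intro i k m hm
  have := hA i (f k) m hm
  rw [hf] at this
  exact this

theorem submatrix_mem_Gr_id {A : Matrix I J (AddMonoidAlgebra R L)} (hA : A ∈ Gr R D ψ w w')
    {f : K → I} (hf : ∀ k, w (f k) = v k) : A.submatrix f id ∈ Gr R D ψ v w' := by
  intro k j m hm
  have := hA (f k) j m hm
  rw [hf] at this
  exact this

end Blocks

/-! ### The Laurent splitting -/

section Interior

variable {R : Type*} [CommRing R] {L : Type*} [AddCommGroup L] {P : Type*} [AddCommGroup P]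
variable {I J : Type*} [Fintype I] [Fintype J] [DecidableEq J]
  {ι : Type*} {l : ι → L →+ ℤ} {ψ : L →+ P}
  {q : I → P} {p : J → P}

/-- Suppose that the face contains an invariant monomial in its interior. Over the ring of Laurent
polynomials, an idempotent that splits near the boundary of the face splits, through matrices which
are related by integral matrices `C` and `D` to the given ones. -/
theorem exists_laurent_splitting {Z : Finset ι} [Nontrivial R] {k₀ : ι} (hk₀ : k₀ ∉ Z)
    (HS : InvariantsSplit R (face l Z) ψ)
    {r : P → P} {b : I → L} {b' : J → L} {c : L} (hψc : ψ c = 0) (hc : c ∈ lineal l Z)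
    (hbl : ∀ i, b i ∈ lineal l Z) (hbl' : ∀ j, b' j ∈ lineal l Z)
    (hb : ∀ i, ψ (b i) = q i - r (q i)) (hb' : ∀ j, ψ (b' j) = p j - r (p j))
    (hr : ∀ x y, ∀ m ∈ face l Z, ψ m = r y - r x → r x = r y)
    {τ : ℤ}
    (F₁ : ∀ x y : J ⊕ I, ∀ m ∈ face l Z, c + Sum.elim b' b x - Sum.elim b' b y + m ∈
      interior l Z 1)
    (F₂ : ∀ x y : J ⊕ I, ∀ m ∈ interior l Z τ, 0 + Sum.elim b' b x - Sum.elim b' b y + m ∈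
      interior l Z 1)
    (F₃ : ∀ x y : J ⊕ I, ∀ m ∈ interior l Z τ, -c + Sum.elim b' b x - Sum.elim b' b y + m ∈
      interior l Z 1)
    {e V : Matrix I I (AddMonoidAlgebra R L)} {X : Matrix I J (AddMonoidAlgebra R L)}
    {H : Matrix J I (AddMonoidAlgebra R L)}
    (he : e ∈ Gr R (face l Z) ψ q q) (hee : e * e = e) (hX : X ∈ Gr R (face l Z) ψ q p)
    (hH : H ∈ Gr R (face l Z) ψ p q) (heX : e * X = X) (hHe : H * e = H)
    (hXH : X * H = e - V) (hV : V ∈ Gr R (interior l Z τ) ψ q q) (heV : e * V = V)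
    (hVe : V * e = V) (hHX : 1 - H * X ∈ Gr R (interior l Z τ) ψ p p) :
    ∃ v ∈ Gr R (lineal l Z) ψ (r ∘ q) (r ∘ p), ∃ v' ∈ Gr R (lineal l Z) ψ (r ∘ p) (r ∘ q),
    ∃ C ∈ Gr R (face l Z) ψ (r ∘ p) (r ∘ p), ∃ D ∈ Gr R (face l Z) ψ (r ∘ p) (r ∘ p),
      v * v' = shift 0 b b e ∧ v' * v = 1 ∧ v * C = shift 0 b b' X ∧ D * v' = shift 0 b' b H ∧
      C * D = 1 - v' * shift 0 b b V * v ∧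
      1 - D * C ∈ Gr R (interior l Z 1) ψ (r ∘ p) (r ∘ p) := by
  have hψc' : ψ (-c) = 0 := by rw [map_neg, hψc, neg_zero]
  have hψ0 : ψ (0 : L) = 0 := map_zero ψ
  have hint : Gr R (interior l Z τ) ψ q q ≤ Gr R (face l Z) ψ q q := Gr_mono (interior_subset _ _)
  -- the projective module glued from the two splittings
  set Φ : Matrix I (J ⊕ I) (AddMonoidAlgebra R L) :=
    Matrix.fromCols (shift 0 b b' X) (shift c b b e) with hΦ
  set Ψ : Matrix (J ⊕ I) I (AddMonoidAlgebra R L) :=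
    Matrix.fromRows (shift 0 b' b H) (shift (-c) b b V) with hΨ
  -- The shifts by `c` and `-c` cancel, leaving `X * H + e * V = e`. Hence `Ψ * Φ` is an idempotent
  -- that is isomorphic to `e` over the Laurent ring.
  have hΦΨ : Φ * Ψ = shift 0 b b e := by
    rw [hΦ, hΨ, Matrix.fromCols_mul_fromRows, shift_mul_shift, shift_mul_shift, hXH, heV, zero_add,
      add_neg_cancel, ← map_add, sub_add_cancel]
  have heΦ : shift 0 b b e * Φ = Φ := by
    rw [hΦ, Matrix.mul_fromCols, shift_mul_shift, shift_mul_shift, heX, hee, zero_add, zero_add]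
  have hΨe : Ψ * shift 0 b b e = Ψ := by
    rw [hΨ, Matrix.fromRows_mul, shift_mul_shift, shift_mul_shift, hHe, hVe, add_zero, add_zero]
  have hHXf : shift 0 b' b' (H * X) ∈ Gr R (face l Z) ψ (r ∘ p) (r ∘ p) := by
    have h1 : shift 0 b' b' (1 - H * X) ∈ Gr R (interior l Z 1) ψ (r ∘ p) (r ∘ p) :=
      shift_mem hHX (fun i j => F₂ (.inl i) (.inl j)) hψ0 hb' hb'
    rw [map_sub, shift_one] at h1
    have h2 := sub_mem (one_mem_Gr (zero_mem _)) (Gr_mono (interior_subset _ _) h1)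
    rwa [sub_sub_cancel] at h2
  have hHXi : 1 - shift 0 b' b' (H * X) ∈ Gr R (interior l Z 1) ψ (r ∘ p) (r ∘ p) := by
    have h1 : shift 0 b' b' (1 - H * X) ∈ Gr R (interior l Z 1) ψ (r ∘ p) (r ∘ p) :=
      shift_mem hHX (fun i j => F₂ (.inl i) (.inl j)) hψ0 hb' hb'
    rwa [map_sub, shift_one] at h1
  have hΨX : Ψ * shift 0 b b' X ∈
      Gr R (face l Z) ψ (Sum.elim (r ∘ p) (r ∘ q)) (r ∘ p) := by
    rw [hΨ, Matrix.fromRows_mul, shift_mul_shift, shift_mul_shift, add_zero, add_zero]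
    refine fromRows_mem_Gr hHXf (Gr_mono (interior_subset Z 1) ?_)
    exact shift_mem (Gr_interior_mul_face hV hX) (fun i j => F₃ (.inr i) (.inl j)) hψc' hb hb'
  have hHΦ : shift 0 b' b H * Φ ∈
      Gr R (face l Z) ψ (r ∘ p) (Sum.elim (r ∘ p) (r ∘ q)) := by
    rw [hΦ, Matrix.mul_fromCols, shift_mul_shift, shift_mul_shift, zero_add, zero_add]
    refine fromCols_mem_Gr hHXf (Gr_mono (interior_subset Z 1) ?_)
    exact shift_mem (Gr_mul_mem hH he) (fun i j => F₁ (.inl i) (.inr j)) hψc hb' hb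
  have hΨe' : Ψ * shift c b b e ∈
      Gr R (face l Z) ψ (Sum.elim (r ∘ p) (r ∘ q)) (r ∘ q) := by
    rw [hΨ, Matrix.fromRows_mul, shift_mul_shift, shift_mul_shift, zero_add, neg_add_cancel]
    refine fromRows_mem_Gr (Gr_mono (interior_subset Z 1) ?_) (Gr_mono (interior_subset Z 1) ?_)
    · exact shift_mem (Gr_mul_mem hH he) (fun i j => F₁ (.inl i) (.inr j)) hψc hb' hb
    · exact shift_mem (Gr_interior_mul_face hV he) (fun i j => F₂ (.inr i) (.inr j)) hψ0 hb hb
  -- All four blocks are integral: `H * X` is `1` up to great depth, the block shifted by `c` gains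
  -- depth from `c`, and in the other two the depth of `V` outweighs the shift.
  have hE : Ψ * Φ ∈ Gr R (face l Z) ψ (Sum.elim (r ∘ p) (r ∘ q)) (Sum.elim (r ∘ p) (r ∘ q)) := by
    rw [hΦ, Matrix.mul_fromCols]
    exact fromCols_mem_Gr hΨX hΨe'
  have hEE : Ψ * Φ * (Ψ * Φ) = Ψ * Φ := by
    rw [Matrix.mul_assoc, ← Matrix.mul_assoc Φ, hΦΨ, heΦ]
  have hΨVΦ : Ψ * shift 0 b b V * Φ ∈
      Gr R (interior l Z 1) ψ (Sum.elim (r ∘ p) (r ∘ q)) (Sum.elim (r ∘ p) (r ∘ q)) := by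
    rw [hΨ, hΦ, Matrix.mul_fromCols, Matrix.fromRows_mul, Matrix.fromRows_mul, Matrix.fromRows_mul]
    simp only [shift_mul_shift, add_zero, zero_add, neg_add_cancel]
    refine fromCols_mem_Gr (fromRows_mem_Gr ?_ ?_) (fromRows_mem_Gr ?_ ?_)
    · exact shift_mem (Gr_interior_mul_face (Gr_face_mul_interior hH hV) hX)
        (fun i j => F₂ (.inl i) (.inl j)) hψ0 hb' hb'
    · exact shift_mem (Gr_interior_mul_face (Gr_face_mul_interior (hint hV) hV) hX)
        (fun i j => F₃ (.inr i) (.inl j)) hψc' hb hb'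
    · exact shift_mem (Gr_mul_mem (Gr_mul_mem hH (hint hV)) he)
        (fun i j => F₁ (.inl i) (.inr j)) hψc hb' hb
    · exact shift_mem (Gr_interior_mul_face (Gr_face_mul_interior (hint hV) hV) he)
        (fun i j => F₂ (.inr i) (.inr j)) hψ0 hb hb
  obtain ⟨W, _, _, wW, hwW, S, hS, S', hS', hSS', hS'S⟩ := HS.splits hE hEE (by
    intro m hm i j hij
    rcases i with i | i <;> rcases j with j | j <;> exact hr _ _ m hm hij)
  have hCD : S' * (Ψ * shift 0 b b' X) * (shift 0 b' b H * Φ * S) =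
      1 - S' * (Ψ * shift 0 b b V * Φ) * S := by
    calc _ = S' * (Ψ * (shift 0 b b' X * shift 0 b' b H) * Φ) * S := by
          simp only [Matrix.mul_assoc]
      _ = S' * (Ψ * Φ) * S - S' * (Ψ * shift 0 b b V * Φ) * S := by
          rw [shift_mul_shift, hXH, add_zero, map_sub, Matrix.mul_sub, hΨe, Matrix.sub_mul,
            Matrix.mul_sub, Matrix.sub_mul]
      _ = _ := by
          rw [← hSS', ← Matrix.mul_assoc S', hS'S, Matrix.one_mul, hS'S]
  have hvv' : Φ * S * (S' * Ψ) = shift 0 b b e := by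
    rw [Matrix.mul_assoc, ← Matrix.mul_assoc S, hSS', Matrix.mul_assoc Ψ, hΦΨ, hΨe, hΦΨ]
  have hv'v : S' * Ψ * (Φ * S) = 1 := by
    rw [Matrix.mul_assoc, ← Matrix.mul_assoc Ψ, ← hSS', Matrix.mul_assoc, hS'S, Matrix.mul_one,
      hS'S]
  have hDC : shift 0 b' b H * Φ * S * (S' * (Ψ * shift 0 b b' X)) = shift 0 b' b' (H * X) := by
    calc _ = shift 0 b' b H * (Φ * S * (S' * Ψ)) * shift 0 b b' X := by
          simp only [Matrix.mul_assoc]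
      _ = _ := by rw [hvv', shift_mul_shift, shift_mul_shift, hHe, add_zero, add_zero]
  have hC : S' * (Ψ * shift 0 b b' X) ∈ Gr R (face l Z) ψ wW (r ∘ p) := Gr_mul_mem hS' hΨX
  have hD : shift 0 b' b H * Φ * S ∈ Gr R (face l Z) ψ (r ∘ p) wW := Gr_mul_mem hHΦ hS
  have hface : (face l Z : Set L) ⊆ lineal l Z := face_le_lineal Z
  have hΦl : Φ ∈ Gr R (lineal l Z) ψ (r ∘ q) (Sum.elim (r ∘ p) (r ∘ q)) := by
    refine fromCols_mem_Gr ?_ ?_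
    · exact shift_mem hX (fun i j m hm => add_mem (sub_mem (add_mem (zero_mem _) (hbl i)) (hbl' j))
        (hface hm)) hψ0 hb hb'
    · exact shift_mem he (fun i j m hm => add_mem (sub_mem (add_mem hc (hbl i)) (hbl j))
        (hface hm)) hψc hb hb
  have hΨl : Ψ ∈ Gr R (lineal l Z) ψ (Sum.elim (r ∘ p) (r ∘ q)) (r ∘ q) := by
    refine fromRows_mem_Gr ?_ ?_
    · exact shift_mem hH (fun i j m hm => add_mem (sub_mem (add_mem (zero_mem _) (hbl' i)) (hbl j))
        (hface hm)) hψ0 hb' hb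
    · exact shift_mem hV (fun i j m hm => add_mem (sub_mem (add_mem (neg_mem hc) (hbl i)) (hbl j))
        (hface (interior_subset _ _ hm))) hψc' hb hb
  have hSl := Gr_mono hface hS
  have hSl' := Gr_mono hface hS'
  have hladd : ∀ a ∈ (lineal l Z : Set L), ∀ b ∈ (lineal l Z : Set L), a + b ∈ (lineal l Z : Set L) :=
    fun a ha b hb => add_mem ha hb
  -- comparison of the weights
  obtain ⟨φ, hφ⟩ : ∃ φ : W ≃ J, ∀ v, (r ∘ p) (φ v) = wW v := by
    have hwr : ∀ v, ∃ x, r x = wW v := fun v => by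
      obtain ⟨i | i, hi⟩ := hwW v
      exacts [⟨_, hi⟩, ⟨_, hi⟩]
    -- Both products of `C` and `D` are `1` up to the interior, so these matrices become mutually
    -- inverse on the facet `k₀`. Their entries still join only equal weights because the weights
    -- are normalized.
    refine exists_equiv_of_mul_eq_one
      (C := (S' * (Ψ * shift 0 b b' X)).map (eps l {k₀}))
      (D := (shift 0 b' b H * Φ * S).map (eps l {k₀})) ?_ ?_ ?_ ?_
    · rw [← map_eps_mul hC hD, hCD, map_eps_sub, map_eps_one, map_eps_eq_zero_of_mem_interior
        (Gr_interior_mul_face (Gr_face_mul_interior hS' hΨVΦ) hS) hk₀, sub_zero]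
    · have h1 := map_eps_eq_zero_of_mem_interior hHXi hk₀
      rw [map_eps_sub, map_eps_one, sub_eq_zero] at h1
      rw [← map_eps_mul hD hC, hDC, h1]
    · intro v j hne
      have hne' : (S' * (Ψ * shift 0 b b' X)) v j ≠ 0 := fun h0 => hne (by
        rw [Matrix.map_apply, h0, map_zero])
      by_contra hcon
      refine hne' (SuppIn.eq_zero ((hC v j).mono fun m hm => hcon ?_))
      obtain ⟨x, hx⟩ := hwr v
      rw [← hx] at hm ⊢
      exact hr _ _ m hm.1 hm.2
    · intro j v hne
      have hne' : (shift 0 b' b H * Φ * S) j v ≠ 0 := fun h0 => hne (by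
        rw [Matrix.map_apply, h0, map_zero])
      by_contra hcon
      refine hne' (SuppIn.eq_zero ((hD j v).mono fun m hm => hcon ?_))
      obtain ⟨x, hx⟩ := hwr v
      rw [← hx] at hm ⊢
      exact (hr _ _ m hm.1 hm.2).symm
  have hφ' : ∀ j, wW (φ.symm j) = (r ∘ p) j := fun j => by rw [← hφ, Equiv.apply_symm_apply]
  refine ⟨(Φ * S).submatrix id φ.symm, submatrix_id_mem_Gr (Gr_mul hΦl hSl hladd) hφ',
    (S' * Ψ).submatrix φ.symm id, submatrix_mem_Gr_id (Gr_mul hSl' hΨl hladd) hφ',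
    (S' * (Ψ * shift 0 b b' X)).submatrix φ.symm id, submatrix_mem_Gr_id hC hφ',
    (shift 0 b' b H * Φ * S).submatrix id φ.symm, submatrix_id_mem_Gr hD hφ', ?_, ?_, ?_, ?_, ?_, ?_⟩
  · rw [Matrix.submatrix_mul_equiv, hvv', Matrix.submatrix_id_id]
  · rw [← Matrix.submatrix_mul _ _ _ id _ Function.bijective_id, hv'v, Matrix.submatrix_one_equiv]
  · rw [Matrix.submatrix_mul_equiv, ← Matrix.mul_assoc S', ← Matrix.mul_assoc (Φ * S), hvv', shift_mul_shift, heX, add_zero, Matrix.submatrix_id_id]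
  · rw [Matrix.submatrix_mul_equiv, Matrix.mul_assoc _ Φ, Matrix.mul_assoc _ (Φ * S), hvv', shift_mul_shift, hHe, add_zero, Matrix.submatrix_id_id]
  · rw [← Matrix.submatrix_mul _ _ _ id _ Function.bijective_id, hCD, Matrix.submatrix_sub,
      Pi.sub_apply, Pi.sub_apply, Matrix.submatrix_one_equiv,
      show S' * (Ψ * shift 0 b b V * Φ) * S = S' * Ψ * shift 0 b b V * (Φ * S) by
        simp only [Matrix.mul_assoc]]
    rfl
  · rw [Matrix.submatrix_mul_equiv, hDC, Matrix.submatrix_id_id]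
    exact hHXi

end Interior

/-! ### Induction over faces -/

section Main

variable {R : Type*} [CommRing R] {L : Type*} [AddCommGroup L] {P : Type*} [AddCommGroup P]
variable {I J : Type*} [Fintype I] [DecidableEq I] [DecidableEq J]
  {ι : Type*} [Fintype ι] [DecidableEq ι] {l : ι → L →+ ℤ} {ψ : L →+ P}
  {q : I → P} {p : J → P} {Z : Finset ι}

theorem shift_diagonal_mem {r : P → P} {b : J → L} {d : J → AddMonoidAlgebra R L} {D : Set L}
    (hd : Matrix.diagonal d ∈ Gr R D ψ (r ∘ p) (r ∘ p)) :
    shift 0 b b (Matrix.diagonal d) ∈ Gr R D ψ p p := by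
  rw [shift_diagonal]
  intro i j
  rw [Matrix.diagonal_apply]
  split_ifs with h
  · subst h
    have := hd i i
    rw [Matrix.diagonal_apply_eq] at this
    exact this.mono fun m hm => ⟨hm.1, by rw [hm.2, sub_self, sub_self]⟩
  · exact suppIn_zero _

variable [Fintype J]

/-- The Laurent splitting `v`, `v'` may be changed to `v * G`, `G⁻¹ * v'` with `G` integral and
invertible. `G` is chosen so that `G⁻¹ * C` is `1` up to the interior even after the weights are
shifted back; then comparison with the integral `X` and `H` excludes poles. -/
theorem splits_of_laurent_splitting {r : P → P} {b : I → L} {b' : J → L}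
    (hbl : ∀ i, b i ∈ lineal l Z) (hbl' : ∀ j, b' j ∈ lineal l Z)
    (hb : ∀ i, ψ (b i) = q i - r (q i)) (hb' : ∀ j, ψ (b' j) = p j - r (p j)) {τ : ℕ}
    (F : ∀ x y, ∀ m ∈ interior l Z (τ + 1), 0 + (-b') x - (-b') y + m ∈ interior l Z 1)
    {e V : Matrix I I (AddMonoidAlgebra R L)} {X : Matrix I J (AddMonoidAlgebra R L)}
    {H : Matrix J I (AddMonoidAlgebra R L)} (hX : X ∈ Gr R (face l Z) ψ q p)
    (hH : H ∈ Gr R (face l Z) ψ p q) (hV : V ∈ Gr R (interior l Z 1) ψ q q)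
    (hVe : V * e = V) {v : Matrix I J (AddMonoidAlgebra R L)}
    {v' : Matrix J I (AddMonoidAlgebra R L)} {C D : Matrix J J (AddMonoidAlgebra R L)}
    (hv : v ∈ Gr R (lineal l Z) ψ (r ∘ q) (r ∘ p)) (hv' : v' ∈ Gr R (lineal l Z) ψ (r ∘ p) (r ∘ q))
    (hC : C ∈ Gr R (face l Z) ψ (r ∘ p) (r ∘ p)) (hD : D ∈ Gr R (face l Z) ψ (r ∘ p) (r ∘ p))
    (hvv' : v * v' = shift 0 b b e) (hv'v : v' * v = 1) (hvC : v * C = shift 0 b b' X)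
    (hDv' : D * v' = shift 0 b' b H) (hCD : C * D = 1 - v' * shift 0 b b V * v)
    (hDC : 1 - D * C ∈ Gr R (interior l Z 1) ψ (r ∘ p) (r ∘ p)) :
    Splits (face l Z) ψ q p e := by
  have hψ0 : ψ (0 : L) = 0 := map_zero ψ
  -- On each facet `D` is a left inverse of `C`, hence a two-sided one since the matrices are
  -- square. A unit `g` with the facet images of `C` makes `g⁻¹ * C` equal to `1` on every facet.
  obtain ⟨g, hg, g', hg', hgg', hg'g, hgC⟩ := exists_unit_lift_Gr (Finset.univ \ Z) hC (by
    intro j hj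
    refine ⟨D.map (eps l {j}), map_eps_mem_self hD _, ?_⟩
    have h1 : D.map (eps l {j}) * C.map (eps l {j}) = 1 := by
      have h1 := map_eps_eq_zero_of_mem_interior hDC (Finset.mem_sdiff.1 hj).2
      rw [map_eps_sub, map_eps_one, sub_eq_zero] at h1
      rw [← map_eps_mul hD hC, ← h1]
    exact ⟨mul_eq_one_comm.1 h1, h1⟩)
  have hC1 : g' * C - 1 ∈ Gr R (interior l Z 1) ψ (r ∘ p) (r ∘ p) := by
    refine mem_interior_of_map_eps_eq_zero
      (sub_mem (Gr_mul_mem hg' hC) (one_mem_Gr (zero_mem _))) fun j hj => ?_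
    rw [map_eps_sub, map_eps_mul hg' hC, ← hgC j (by simp [hj]), ← map_eps_mul hg' hg, hg'g,
      sub_self]
  obtain ⟨u, hu, u', hu', huu', hu'u, d, hd, hO⟩ := exists_mul_eq_diagonal_add hC1 τ
  set G := g * u' with hG
  set G' := u * g' with hG'
  have hGG' : G * G' = 1 := by
    rw [hG, hG', Matrix.mul_assoc, ← Matrix.mul_assoc u', hu'u, Matrix.one_mul, hgg']
  have hG'G : G' * G = 1 := by
    rw [hG, hG', Matrix.mul_assoc, ← Matrix.mul_assoc g', hg'g, Matrix.one_mul, huu']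
  have hGm : G ∈ Gr R (face l Z) ψ (r ∘ p) (r ∘ p) := Gr_mul_mem hg hu'
  have hGm' : G' ∈ Gr R (face l Z) ψ (r ∘ p) (r ∘ p) := Gr_mul_mem hu hg'
  have hladd : ∀ a ∈ (lineal l Z : Set L), ∀ b ∈ (lineal l Z : Set L), a + b ∈ (lineal l Z : Set L) :=
    fun a ha b hb => add_mem ha hb
  have hnb : ∀ i, ψ ((-b) i) = (r ∘ q) i - q i := fun i => by
    rw [Pi.neg_apply, map_neg, hb, neg_sub]; rfl
  have hnb' : ∀ i, ψ ((-b') i) = (r ∘ p) i - p i := fun i => by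
    rw [Pi.neg_apply, map_neg, hb', neg_sub]; rfl
  have hnbl : ∀ i, (-b) i ∈ lineal l Z := fun i => neg_mem (hbl i)
  have hnbl' : ∀ i, (-b') i ∈ lineal l Z := fun i => neg_mem (hbl' i)
  -- `G' * C` is `1` up to the interior, after shifting back
  obtain ⟨K, hK, hKG⟩ : ∃ K ∈ Gr R (interior l Z 1) ψ p p,
      shift 0 (-b') (-b') (G' * C) = 1 + K := by
    refine ⟨shift 0 (-b') (-b') (Matrix.diagonal d - 1) +
      shift 0 (-b') (-b') (G' * C - Matrix.diagonal d), add_mem ?_ ?_, ?_⟩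
    · rw [← Matrix.diagonal_one, Matrix.diagonal_sub] at hd ⊢
      exact shift_diagonal_mem hd
    · rw [hG', Matrix.mul_assoc]
      exact shift_mem hO F hψ0 hnb' hnb'
    · rw [← map_add, show Matrix.diagonal d - 1 + (G' * C - Matrix.diagonal d) = G' * C - 1 by abel,
        map_sub, shift_one]
      abel
  have h1K : 1 + K ∈ Gr R (face l Z) ψ p p :=
    add_mem (one_mem_Gr (zero_mem _)) (Gr_mono (interior_subset _ _) hK)
  have hface : (face l Z : Set L) ⊆ lineal l Z := face_le_lineal Z
  have hXn : shift 0 (-b) (-b') (v * G) ∈ Gr R (face l Z) ψ q p := by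
    refine mem_face_of_mul_mem (l := l) (Z := Z) ?_ hK ?_
    · exact shift_mem (Gr_mul hv (Gr_mono hface hGm) hladd) (fun i j m hm =>
        add_mem (sub_mem (add_mem (zero_mem _) (hnbl i)) (hnbl' j)) hm) hψ0 hnb hnb'
    · rw [← hKG, shift_mul_shift, Matrix.mul_assoc, ← Matrix.mul_assoc G, hGG', Matrix.one_mul, hvC,
        add_zero, shift_neg_shift]
      exact hX
  have hYn : shift 0 (-b') (-b) (G' * v') ∈ Gr R (face l Z) ψ p q := by
    refine mem_face_of_mul_mem (l := l) (Z := Z) ?_ (neg_mem hV) ?_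
    · exact shift_mem (Gr_mul (Gr_mono hface hGm') hv' hladd) (fun i j m hm =>
        add_mem (sub_mem (add_mem (zero_mem _) (hnbl' i)) (hnbl j)) hm) hψ0 hnb' hnb
    -- The new `Y` times `1 - V` equals `(1 + K) * H`, which is integral; as `V` lies in the
    -- interior, the new `Y` has no poles either.
    · have h1 : G' * C * shift 0 b' b H = G' * v' * (1 - shift 0 b b V) := by
        calc G' * C * shift 0 b' b H = G' * (C * D) * v' := by
              rw [← hDv']; simp only [Matrix.mul_assoc]
          _ = G' * v' - G' * v' * (shift 0 b b V * (v * v')) := by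
              rw [hCD, Matrix.mul_sub, Matrix.sub_mul, Matrix.mul_one]; simp only [Matrix.mul_assoc]
          _ = _ := by rw [hvv', shift_mul_shift, hVe, add_zero, Matrix.mul_sub, Matrix.mul_one]
      have h2 : shift 0 (-b') (-b) (G' * v') * (1 + -V) = (1 + K) * H := by
        have h3 : (1 + -V) = shift 0 (-b) (-b) (1 - shift 0 b b V) := by
          rw [map_sub, shift_one, shift_neg_shift, sub_eq_add_neg]
        have h4 : H = shift 0 (-b') (-b) (shift 0 b' b H) := (shift_neg_shift _ _ _).symm
        rw [h3, shift_mul_shift, ← h1, ← hKG, h4, shift_mul_shift, ← h4]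
      rw [h2]
      exact Gr_mul_mem h1K hH
  refine ⟨_, hXn, _, hYn, ?_, ?_⟩
  · rw [shift_mul_shift, Matrix.mul_assoc, ← Matrix.mul_assoc G, hGG', Matrix.one_mul, hvv',
      add_zero, shift_neg_shift]
  · rw [shift_mul_shift, Matrix.mul_assoc, ← Matrix.mul_assoc v', hv'v, Matrix.one_mul, hG'G,
      add_zero, shift_one]

omit [DecidableEq I] [Fintype ι] [DecidableEq ι] in
theorem improve_mem_Gr {S : AddSubmonoid L} {X : Matrix I J (AddMonoidAlgebra R L)}
    {Y : Matrix J I (AddMonoidAlgebra R L)} (hX : X ∈ Gr R (S : Set L) ψ q p)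
    (hY : Y ∈ Gr R (S : Set L) ψ p q) (τ : ℕ) : improve X Y τ ∈ Gr R (S : Set L) ψ p q := by
  refine Gr_mul_mem (sum_mem fun t _ => ?_) hY
  have h : 1 - Y * X ∈ grRing R S ψ p := sub_mem (one_mem _) (mem_grRing.2 (Gr_mul_mem hY hX))
  exact pow_mem h t

/-- The element `s` supplies shifts of degree `0` that push any bounded rescaling back into the
interior. The errors of `X`, `Y` are first raised to a power large enough to survive the opposite
shift. -/
theorem splits_of_interior (HS : InvariantsSplit R (face l Z) ψ) {k₀ : ι} (hk₀ : k₀ ∉ Z) {s : L}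
    (hs : s ∈ face l Z) (hψs : ψ s = 0) (hsZ : ∀ j ∉ Z, 0 < l j s)
    {e : Matrix I I (AddMonoidAlgebra R L)} {X : Matrix I J (AddMonoidAlgebra R L)}
    {Y : Matrix J I (AddMonoidAlgebra R L)} (he : e ∈ Gr R (face l Z) ψ q q) (hee : e * e = e)
    (hX : X ∈ Gr R (face l Z) ψ q p) (hY : Y ∈ Gr R (face l Z) ψ p q) (heX : e * X = X)
    (hYe : Y * e = Y) (hN : 1 - Y * X ∈ Gr R (interior l Z 1) ψ p p)
    (hN' : e - X * Y ∈ Gr R (interior l Z 1) ψ q q) : Splits (face l Z) ψ q p e := by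
  rcases subsingleton_or_nontrivial R with hR | hR
  · exact ⟨0, zero_mem _, 0, zero_mem _, Subsingleton.elim _ _, Subsingleton.elim _ _⟩
  obtain ⟨a, r, ha, hψa, hr⟩ := exists_coset_representatives ψ (lineal l Z)
  obtain ⟨τ₀, hτ₀⟩ := exists_bound l (Set.range (Sum.elim (a ∘ p) (a ∘ q))) (Set.finite_range _)
  obtain ⟨σ₀, hσ₀⟩ := exists_bound l {s} (Set.finite_singleton s)
  have hr' : ∀ x y, ∀ m ∈ face l Z, ψ m = r y - r x → r x = r y := by
    have hrr : ∀ x, r (r x) = r x := fun x => hr _ _ (a x) (ha x) (hψa x)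
    intro x y m hm h
    rw [← hrr x, ← hrr y]
    exact hr _ _ m (face_le_lineal Z hm) h
  have hint : ∀ m, m ∈ lineal l Z → (∀ j ∉ Z, 1 ≤ l j m) → m ∈ interior l Z 1 := by
    refine fun m hm h => ⟨⟨fun j => ?_, hm⟩, h⟩
    by_cases hj : j ∈ Z
    · rw [hm j hj]
    · exact zero_le_one.trans (h j hj)
  have hβl : ∀ x, Sum.elim (a ∘ p) (a ∘ q) x ∈ lineal l Z := by
    rintro (x | x) <;> exact ha _
  have hβ : ∀ x j, |l j (Sum.elim (a ∘ p) (a ∘ q) x)| ≤ τ₀ := fun x j => hτ₀ _ ⟨x, rfl⟩ j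
  have hsl : s ∈ lineal l Z := face_le_lineal Z hs
  -- Rescaling a row and a column costs depth at most `2 * τ₀`. Since `l j s ≥ 1` off `Z`, the shift
  -- `c = (2 * τ₀ + 1) • s` gains at least `2 * τ₀ + 1`, while `-c` costs at most `(2 * τ₀ + 1) *
  -- σ₀`. Depth `τ + 1` therefore leaves at least `1` in every case.
  set τ : ℕ := (2 * τ₀ + 1) * σ₀ + 2 * τ₀ with hτ
  set c : L := (2 * τ₀ + 1) • s with hc
  have hcl : ∀ j, l j c = (2 * τ₀ + 1) * l j s := fun j => by
    rw [hc, map_nsmul, nsmul_eq_mul]; push_cast; rfl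
  have hNτ := pow_mem_interior hN (τ + 1)
  have hN'τ := pow_mem_interior hN' (τ + 1)
  have heN : e * (e - X * Y) = e - X * Y := by rw [Matrix.mul_sub, hee, ← Matrix.mul_assoc, heX]
  have hV : (e - X * Y) ^ (τ + 1) * e ∈ Gr R (interior l Z (τ + 1 : ℕ)) ψ q q :=
    Gr_interior_mul_face hN'τ he
  have hVe : (e - X * Y) ^ (τ + 1) * e * e = (e - X * Y) ^ (τ + 1) * e := by
    rw [Matrix.mul_assoc, hee]
  have hH := improve_mem_Gr hX hY (τ + 1)
  obtain ⟨v, hv, v', hv', C, hC, D, hD, h1, h2, h3, h4, h5, h6⟩ :=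
    exists_laurent_splitting (b := a ∘ q) (b' := a ∘ p) (c := c) (r := r)
      (H := improve X Y (τ + 1)) (V := (e - X * Y) ^ (τ + 1) * e) (τ := (τ + 1 : ℕ)) hk₀ HS
      (by rw [hc, map_nsmul, hψs, smul_zero]) (nsmul_mem hsl _) (fun _ => ha _) (fun _ => ha _)
      (fun _ => hψa _) (fun _ => hψa _) hr'
      (by
        intro x y m hm
        refine hint _ (add_mem (sub_mem (add_mem (nsmul_mem hsl _) (hβl x)) (hβl y))
          (face_le_lineal Z hm)) fun j hj => ?_
        rw [map_add, map_sub, map_add, hcl]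
        have := abs_le.1 (hβ x j)
        have := abs_le.1 (hβ y j)
        have := hm.1 j
        nlinarith [hsZ j hj])
      (by
        intro x y m hm
        refine hint _ (add_mem (sub_mem (add_mem (zero_mem _) (hβl x)) (hβl y))
          (face_le_lineal Z hm.1)) fun j hj => ?_
        rw [map_add, map_sub, map_add, map_zero]
        have := abs_le.1 (hβ x j)
        have := abs_le.1 (hβ y j)
        have := hm.2 j hj
        rw [hτ] at this
        push_cast at this
        have : (0 : ℤ) ≤ (2 * τ₀ + 1) * σ₀ := by positivity
        linarith)
      (by
        intro x y m hm
        refine hint _ (add_mem (sub_mem (add_mem (neg_mem (nsmul_mem hsl _)) (hβl x)) (hβl y))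
          (face_le_lineal Z hm.1)) fun j hj => ?_
        rw [map_add, map_sub, map_add, map_neg, hcl]
        have := abs_le.1 (hβ x j)
        have := abs_le.1 (hβ y j)
        have := hm.2 j hj
        rw [hτ] at this
        push_cast at this
        have : (2 * τ₀ + 1 : ℤ) * l j s ≤ (2 * τ₀ + 1) * σ₀ :=
          mul_le_mul_of_nonneg_left (abs_le.1 (hσ₀ s rfl j)).2 (by positivity)
        linarith)
      he hee hX hH heX (improve_mul_right hYe _) (mul_improve hee heX hYe _) hV
      (by rw [pow_succ', ← Matrix.mul_assoc, ← Matrix.mul_assoc, heN]) hVe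
      (by rw [improve_mul, sub_sub_cancel]; exact hNτ)
  refine splits_of_laurent_splitting (b := a ∘ q) (b' := a ∘ p) (r := r) (τ := τ) (fun _ => ha _)
    (fun _ => ha _) (fun _ => hψa _) (fun _ => hψa _) ?_ hX hH
    (Gr_mono (interior_anti Z (by push_cast; linarith)) hV) hVe hv hv' hC hD h1 h2 h3 h4 h5 h6
  intro x y m hm
  refine hint _ (add_mem (sub_mem (add_mem (zero_mem _) (neg_mem (ha _))) (neg_mem (ha _)))
    (face_le_lineal Z hm.1)) fun j hj => ?_
  rw [map_add, map_sub, map_add, map_zero, Pi.neg_apply, Pi.neg_apply, map_neg, map_neg]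
  have h7 := abs_le.1 (hβ (.inl x) j)
  have h8 := abs_le.1 (hβ (.inl y) j)
  simp only [Sum.elim_inl] at h7 h8
  have := hm.2 j hj
  rw [hτ] at this
  push_cast at this
  have : (0 : ℤ) ≤ (2 * τ₀ + 1) * σ₀ := by positivity
  linarith

omit [Fintype I] [DecidableEq I] [Fintype ι] [DecidableEq ι] in
theorem mem_Gr_pos_of_map_eps_eq_zero {k : ι} {M : Matrix I I (AddMonoidAlgebra R L)}
    (hM : M ∈ Gr R (face l Z) ψ q q) (h : M.map (eps l {k}) = 0) :
    M ∈ Gr R {m | m ∈ face l Z ∧ 0 < l k m} ψ q q := by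
  intro i j m hm
  obtain ⟨h1, h2⟩ := hM i j m hm
  obtain ⟨k', hk', hne⟩ := suppIn_of_eps_eq_zero (congr_fun (congr_fun h i) j) m hm
  rw [Finset.mem_singleton] at hk'
  subst hk'
  exact ⟨⟨h1, lt_of_le_of_ne (h1.1 k') hne.symm⟩, h2⟩

omit [Fintype ι] in
-- The errors of a lift from the facet `k` are supported on `l k > 0`, where no degree is `0`. They
-- are nilpotent by `exists_pow_eq_zero`, so the improved inverse is exact.
theorem splits_of_invariants_in_face {k : ι} (hk : ∀ m ∈ face l Z, ψ m = 0 → l k m = 0)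
    {e : Matrix I I (AddMonoidAlgebra R L)} (he : e ∈ Gr R (face l Z) ψ q q) (hee : e * e = e)
    (h : Splits (face l (insert k Z)) ψ q p (e.map (eps l {k}))) : Splits (face l Z) ψ q p e := by
  obtain ⟨X, hX, Y, hY, heX, hYe, hXY⟩ := exists_splitting_on_faces he hee {k} (p := p)
    (by simpa using h)
  obtain ⟨h1, h2⟩ := hXY k (by simp)
  have hD : ∀ a ∈ {m | m ∈ face l Z ∧ 0 < l k m}, ∀ b ∈ {m | m ∈ face l Z ∧ 0 < l k m},
      a + b ∈ {m | m ∈ face l Z ∧ 0 < l k m} := fun a ha b hb =>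
    ⟨add_mem ha.1 hb.1, by rw [map_add]; exact add_pos ha.2 hb.2⟩
  have hD0 : ∀ m ∈ {m | m ∈ face l Z ∧ 0 < l k m}, ψ m ≠ 0 := fun m hm h0 =>
    hm.2.ne' (hk m hm.1 h0)
  have h3 := exists_pow_eq_zero hD hD0 (N := 1 - Y * X) (w := p) (mem_Gr_pos_of_map_eps_eq_zero
    (sub_mem (one_mem_Gr (zero_mem _)) (Gr_mul_mem hY hX))
    (by rw [map_eps_sub, map_eps_one, map_eps_mul hY hX, h2, sub_self]))
  have h4 := exists_pow_eq_zero hD hD0 (N := e - X * Y) (w := q) (mem_Gr_pos_of_map_eps_eq_zero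
    (sub_mem he (Gr_mul_mem hX hY)) (by rw [map_eps_sub, map_eps_mul hX hY, h1, sub_self]))
  refine ⟨X, hX, improve X Y (Fintype.card I + Fintype.card J + 1), improve_mem_Gr hX hY _, ?_, ?_⟩
  · rw [mul_improve hee heX hYe, pow_eq_zero_of_le (by omega) h4, Matrix.zero_mul, sub_zero]
  · rw [improve_mul, pow_eq_zero_of_le (by omega) h3, sub_zero]

/-- Splittings of a graded idempotent extend from the group of units of the monoid to the whole
monoid. -/
theorem splits_of_splits_units (HS : ∀ Z, InvariantsSplit R (face l Z) ψ) (n : ℕ) :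
    ∀ (Z : Finset ι), (Finset.univ \ Z).card = n → ∀ {e : Matrix I I (AddMonoidAlgebra R L)},
      e ∈ Gr R (face l Z) ψ q q → e * e = e →
      Splits (face l Finset.univ) ψ q p (e.map (eps l Finset.univ)) → Splits (face l Z) ψ q p e := by
  induction n with
  | zero =>
    intro Z hZ e he hee h
    have hZ' : Z = Finset.univ := by
      rw [Finset.card_eq_zero, Finset.sdiff_eq_empty_iff_subset] at hZ
      exact Finset.univ_subset_iff.1 hZ
    subst hZ'
    rwa [map_eps_of_mem subset_rfl he] at h
  | succ n ih =>
    intro Z hZ e he hee h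
    have hface : ∀ k ∉ Z, Splits (face l (insert k Z)) ψ q p (e.map (eps l {k})) := by
      intro k hk
      refine ih (insert k Z) ?_ (map_eps_mem_insert he k) (by rw [← map_eps_mul he he, hee]) ?_
      · rw [Finset.sdiff_insert, Finset.card_erase_of_mem (by simp [hk]), hZ, Nat.add_sub_cancel]
      · rw [map_eps_map_eps, Finset.union_eq_left.2 (Finset.subset_univ _)]
        exact h
    obtain ⟨k₀, hk₀⟩ := Finset.card_pos.1 (by omega : 0 < (Finset.univ \ Z).card)
    have hk₀' := (Finset.mem_sdiff.1 hk₀).2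
    -- If there is no such `k`, each `k ∉ Z` has an invariant monomial with `l k > 0`, and the sum
    -- of these is an invariant monomial in the interior.
    by_cases hin : ∃ k ∉ Z, ∀ m ∈ face l Z, ψ m = 0 → l k m = 0
    · obtain ⟨k, hk, hk'⟩ := hin
      exact splits_of_invariants_in_face hk' he hee (hface k hk)
    · push Not at hin
      choose! m hm hψm hlm using hin
      obtain ⟨X, hX, Y, hY, heX, hYe, hXY⟩ := exists_splitting_on_faces he hee (Finset.univ \ Z)
        fun k hk => hface k (Finset.mem_sdiff.1 hk).2
      refine splits_of_interior (HS Z) hk₀' (s := ∑ k ∈ Finset.univ \ Z, m k)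
        (sum_mem fun k hk => hm k (Finset.mem_sdiff.1 hk).2) ?_ ?_ he hee hX hY heX hYe ?_ ?_
      · rw [map_sum]
        exact Finset.sum_eq_zero fun k hk => hψm k (Finset.mem_sdiff.1 hk).2
      · intro j hj
        rw [map_sum]
        refine Finset.sum_pos' (fun k hk => (hm k (Finset.mem_sdiff.1 hk).2).1 j)
          ⟨j, by simp [hj], lt_of_le_of_ne ((hm j hj).1 j) (hlm j hj).symm⟩
      · refine mem_interior_of_map_eps_eq_zero
          (sub_mem (one_mem_Gr (zero_mem _)) (Gr_mul_mem hY hX)) fun j hj => ?_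
        rw [map_eps_sub, map_eps_one, map_eps_mul hY hX, (hXY j (by simp [hj])).2, sub_self]
      · refine mem_interior_of_map_eps_eq_zero (sub_mem he (Gr_mul_mem hX hY)) fun j hj => ?_
        rw [map_eps_sub, map_eps_mul hX hY, (hXY j (by simp [hj])).1, sub_self]

omit [DecidableEq I] [DecidableEq ι] in
-- On this face every monomial is invertible, so normalizing the weights and shifting back stay
-- inside the face ring.
theorem exists_splits_units (HS : InvariantsSplit R (face l Finset.univ) ψ)
    {e : Matrix I I (AddMonoidAlgebra R L)} (he : e ∈ Gr R (face l Finset.univ) ψ q q)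
    (hee : e * e = e) :
    ∃ (V : Type) (_ : Fintype V) (_ : DecidableEq V) (p : V → P),
      Splits (face l Finset.univ) ψ q p e := by
  obtain ⟨a, r, ha, hψa, hr⟩ := exists_coset_representatives ψ (lineal l Finset.univ)
  have hfl : ∀ m, m ∈ lineal l Finset.univ → m ∈ face l Finset.univ := fun m hm =>
    ⟨fun j => (hm j (Finset.mem_univ j)).ge, hm⟩
  have hrr : ∀ x, r (r x) = r x := fun x => hr _ _ (a x) (ha x) (hψa x)
  have h0 : ψ 0 = 0 := map_zero ψ
  have hsh : shift 0 (a ∘ q) (a ∘ q) e ∈ Gr R (face l Finset.univ) ψ (r ∘ q) (r ∘ q) :=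
    shift_mem he (fun i j m hm => add_mem (hfl _ (sub_mem (add_mem (zero_mem _) (ha _)) (ha _))) hm)
      h0 (fun _ => hψa _) (fun _ => hψa _)
  obtain ⟨V, _, _, p, -, S, hS, S', hS', hSS', hS'S⟩ := HS.splits hsh
    (by rw [shift_mul_shift, hee, add_zero]) (by
      intro m hm i j h
      have := hr _ _ m (face_le_lineal _ hm) h
      rwa [Function.comp_apply, Function.comp_apply, hrr, hrr] at this)
  refine ⟨V, inferInstance, inferInstance, p, shift 0 (-(a ∘ q)) (-0) S, ?_, shift 0 (-0) (-(a ∘ q)) S', ?_, ?_, ?_⟩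
  · refine shift_mem hS (fun i j m hm => add_mem (hfl _ (sub_mem (add_mem (zero_mem _)
      (neg_mem (ha _))) (neg_mem (zero_mem _)))) hm) h0 ?_ ?_
    · intro i
      rw [Pi.neg_apply, map_neg, Function.comp_apply, hψa, neg_sub]; rfl
    · simp
  · refine shift_mem hS' (fun i j m hm => add_mem (hfl _ (sub_mem (add_mem (zero_mem _)
      (neg_mem (zero_mem _))) (neg_mem (ha _)))) hm) h0 ?_ ?_
    · simp
    · intro i
      rw [Pi.neg_apply, map_neg, Function.comp_apply, hψa, neg_sub]; rfl
  · rw [shift_mul_shift, hSS', add_zero, shift_neg_shift]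
  · rw [shift_mul_shift, hS'S, add_zero, shift_one]

/-- Every graded idempotent matrix over the monoid algebra of `{m | ∀ j, 0 ≤ l j m}` splits. -/
theorem exists_splits (HS : ∀ Z, InvariantsSplit R (face l Z) ψ)
    {e : Matrix I I (AddMonoidAlgebra R L)} (he : e ∈ Gr R (face l ∅) ψ q q) (hee : e * e = e) :
    ∃ (V : Type) (_ : Fintype V) (_ : DecidableEq V) (p : V → P), Splits (face l ∅) ψ q p e := by
  have h := map_eps_mem he Finset.univ
  rw [Finset.union_empty] at h
  obtain ⟨V, _, _, p, hp⟩ := exists_splits_units (HS _) h (by rw [← map_eps_mul he he, hee])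
  exact ⟨V, inferInstance, inferInstance, p, splits_of_splits_units HS _ ∅ rfl he hee hp⟩

end Main

/-! ### Free modules and split idempotents -/

section Free

theorem exists_split_of_free {B : Type v} [CommRing B]
    (h : ∀ (M : Type v) [AddCommGroup M] [Module B M] [Module.Finite B M] [Module.Projective B M],
      Module.Free B M) {n : ℕ} (e : Matrix (Fin n) (Fin n) B) (he : e * e = e) :
    ∃ (m : ℕ) (S : Matrix (Fin n) (Fin m) B) (S' : Matrix (Fin m) (Fin n) B),
      S * S' = e ∧ S' * S = 1 := by
  let f := Matrix.toLin' e
  have hff : f ∘ₗ f = f := by rw [← Matrix.toLin'_mul, he]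
  have hsplit : f.rangeRestrict ∘ₗ (LinearMap.range f).subtype = LinearMap.id := by
    ext1 ⟨_, y, rfl⟩
    exact Subtype.ext (LinearMap.congr_fun hff y)
  have : Module.Projective B (LinearMap.range f) := Module.Projective.of_split _ _ hsplit
  have := h (LinearMap.range f)
  let b := (Module.Free.chooseBasis B (LinearMap.range f)).reindex (Fintype.equivFin _)
  refine ⟨_, LinearMap.toMatrix' ((LinearMap.range f).subtype ∘ₗ b.equivFun.symm.toLinearMap),
    LinearMap.toMatrix' (b.equivFun.toLinearMap ∘ₗ f.rangeRestrict), ?_, ?_⟩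
  · rw [← LinearMap.toMatrix'_comp, LinearMap.comp_assoc,
      ← LinearMap.comp_assoc _ b.equivFun.toLinearMap]
    simp only [LinearEquiv.comp_coe, LinearEquiv.self_trans_symm, LinearEquiv.refl_toLinearMap,
      LinearMap.id_comp]
    exact LinearMap.toMatrix'_toLin' e
  · rw [← LinearMap.toMatrix'_comp, LinearMap.comp_assoc,
      ← LinearMap.comp_assoc _ (LinearMap.range f).subtype, hsplit]
    simp

theorem free_of_extended {R : Type u} [CommRing R] (hR : SatisfiesDagger R) {B : Type v}
    [CommRing B] [Algebra R B] (hB : FGProjectivesExtended R B) (M : Type v) [AddCommGroup M]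
    [Module B M] [Module.Finite B M] [Module.Projective B M] : Module.Free B M := by
  obtain ⟨N, _, _, _, _, ⟨e⟩⟩ := hB M
  have := hR.free_of_projective N
  exact Module.Free.of_equiv e.symm

end Free

/-! ### Homogeneous components and the ring of invariants -/

section Component

variable (R : Type*) [CommRing R] {P : Type*} (M : Type*) [AddCommGroup M] [Module R M]

/-- The `p`-th component `R[P] ⊗ M → M`. -/
noncomputable def component (p : P) : AddMonoidAlgebra R P ⊗[R] M →ₗ[R] M :=
  (TensorProduct.lid R M).toLinearMap ∘ₗ LinearMap.rTensor M
    ({ toFun := fun x => x.coeff p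
       map_add' := fun x y => by simp
       map_smul' := fun r x => by simp } : AddMonoidAlgebra R P →ₗ[R] R)

variable {R M}

theorem component_tmul (p : P) (x : AddMonoidAlgebra R P) (m : M) :
    component R M p (x ⊗ₜ m) = x.coeff p • m := by
  simp [component]
  rfl

open Classical in
theorem component_single (p q : P) (m : M) :
    component R M p (single q (1 : R) ⊗ₜ m) = if q = p then m else 0 := by
  rw [component_tmul, coeff_single, Finsupp.single_apply]
  split_ifs <;> simp

end Component

section DegreePart

variable {R : Type*} [CommRing R] {Q P : Type*}

open Classical in
/-- The part of degree `p` of an element of `R[Q]`. -/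
noncomputable def degreePart (deg : Q → P) (p : P) :
    AddMonoidAlgebra R Q →ₗ[R] AddMonoidAlgebra R Q where
  toFun x := ofCoeff (x.coeff.filter fun m => deg m = p)
  map_add' x y := by simp [Finsupp.filter_add]
  map_smul' r x := by simp [Finsupp.filter_smul]

open Classical in
theorem coeff_degreePart (deg : Q → P) (p : P) (x : AddMonoidAlgebra R Q) (m : Q) :
    (degreePart deg p x).coeff m = if deg m = p then x.coeff m else 0 := by
  simp [degreePart, Finsupp.filter_apply]

theorem degreePart_of_suppIn {deg : Q → P} {p : P} {x : AddMonoidAlgebra R Q}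
    (h : SuppIn {m | deg m = p} x) : degreePart deg p x = x := by
  classical
  ext m
  rw [coeff_degreePart]
  split_ifs with hm
  · rfl
  · by_contra h0
    exact hm (h m (Ne.symm h0))

theorem degreePart_of_suppIn_ne {deg : Q → P} {p q : P} (hpq : q ≠ p) {x : AddMonoidAlgebra R Q}
    (h : SuppIn {m | deg m = q} x) : degreePart deg p x = 0 := by
  classical
  ext m
  rw [coeff_degreePart]
  split_ifs with hm
  · by_contra h0
    exact hpq ((h m h0).symm.trans hm)
  · rfl

theorem suppIn_degreePart (deg : Q → P) (p : P) (x : AddMonoidAlgebra R Q) :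
    SuppIn {m | deg m = p} (degreePart deg p x) := by
  classical
  intro m hm
  rw [coeff_degreePart] at hm
  by_contra h
  exact hm (if_neg h)

theorem eq_zero_of_degreePart {deg : Q → P} {x : AddMonoidAlgebra R Q}
    (h : ∀ p, degreePart deg p x = 0) : x = 0 := by
  classical
  ext m
  have := coeff_degreePart deg (deg m) x m
  rw [h, if_pos rfl] at this
  exact this.symm

theorem degreePart_mul [AddCommMonoid Q] [AddCommGroup P] (deg : Q →+ P) {d : P}
    {y : AddMonoidAlgebra R Q} (hy : SuppIn {m | deg m = d} y) (p : P)
    (x : AddMonoidAlgebra R Q) :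
    degreePart deg p (x * y) = degreePart deg (p - d) x * y := by
  induction x using AddMonoidAlgebra.induction_linear with
  | zero => simp
  | add x x' hx hx' => rw [add_mul, map_add, hx, hx', map_add, add_mul]
  | single m r =>
    have h1 : SuppIn {m' | deg m' = deg m} (single m r) :=
      suppIn_single (by simp) r
    have h2 : SuppIn {m' | deg m' = deg m + d} (single m r * y) :=
      h1.mul hy fun a ha b hb => by
        simp only [Set.mem_ofPred_eq] at ha hb ⊢
        rw [map_add, ha, hb]
    by_cases h : deg m = p - d
    · rw [← h, degreePart_of_suppIn h1]
      rw [show p = deg m + d by rw [h, sub_add_cancel]]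
      exact degreePart_of_suppIn h2
    · rw [degreePart_of_suppIn_ne h h1, zero_mul]
      exact degreePart_of_suppIn_ne (fun h' => h (eq_sub_of_add_eq h')) h2

end DegreePart

section Invariants

variable {R : Type*} [CommRing R] {L : Type*} [AddCommGroup L] {P : Type*} [AddCommGroup P]

omit [AddCommGroup P] in
theorem suppIn_mapDomain {S : AddSubmonoid L} {ψ : L → P} {d : P} {x : AddMonoidAlgebra R S}
    (hx : SuppIn {m : S | ψ m = d} x) :
    SuppIn {m | m ∈ S ∧ ψ m = d} (mapDomain S.subtype x) := by
  classical
  intro m hm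
  have h1 : m ∈ (Finsupp.mapDomain S.subtype x.coeff).support := Finsupp.mem_support_iff.2 hm
  obtain ⟨m', hm', rfl⟩ := Finset.mem_image.1 (Finsupp.mapDomain_support h1)
  exact ⟨m'.2, hx m' (Finsupp.mem_support_iff.1 hm')⟩

omit [AddCommGroup P] in
theorem exists_mapDomain_eq {S : AddSubmonoid L} {ψ : L → P} {d : P} {y : AddMonoidAlgebra R L}
    (hy : SuppIn {m | m ∈ S ∧ ψ m = d} y) :
    ∃ x : AddMonoidAlgebra R S, SuppIn {m : S | ψ m = d} x ∧ mapDomain S.subtype x = y := by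
  refine ⟨comapDomain S.subtype Subtype.val_injective y, fun m hm => ?_,
    mapDomain_comapDomain (fun m hm => ?_) _⟩
  · exact (hy m (by simpa using hm)).2
  · exact ⟨⟨m, (hy m (Finsupp.mem_support_iff.1 hm)).1⟩, rfl⟩

theorem component_toricCoaction (ψ : L →+ P) (τ : PointedCone ℚ (ℚ ⊗[ℤ] L)) (p : P)
    (x : ToricRing R τ) :
    component R _ p (toricCoaction R ψ τ x) = degreePart (fun m : latticePoints τ => ψ m) p x := by
  induction x using AddMonoidAlgebra.induction_linear with
  | zero => simp
  | add x y hx hy => rw [map_add, map_add, hx, hy, map_add]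
  | single m r =>
    classical
    have : (single m r : ToricRing R τ) = r • single m 1 := by simp
    rw [this, map_smul, map_smul, map_smul, toricCoaction_single, component_single]
    congr 1
    have h1 : SuppIn {m' : latticePoints τ | ψ m' = ψ m} (single m (1 : R)) :=
      suppIn_single (by simp) 1
    split_ifs with h
    · subst h; exact (degreePart_of_suppIn h1).symm
    · exact (degreePart_of_suppIn_ne h h1).symm

theorem mem_invariantSubalgebra_iff (ψ : L →+ P) (τ : PointedCone ℚ (ℚ ⊗[ℤ] L))
    (x : ToricRing R τ) :
    x ∈ invariantSubalgebra (toricCoaction R ψ τ) ↔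
      SuppIn {m : latticePoints τ | ψ m = 0} x := by
  classical
  rw [mem_invariantSubalgebra]
  constructor
  · intro h m hm
    by_contra hne
    have h1 := component_toricCoaction ψ τ (ψ m) x
    rw [h, one_def, component_single, if_neg (Ne.symm hne)] at h1
    have h2 := coeff_degreePart (fun m : latticePoints τ => ψ m) (ψ m) x m
    rw [← h1, if_pos rfl] at h2
    exact hm h2.symm
  · intro h
    have h1 : x = ∑ m ∈ x.coeff.support, x.coeff m • single m 1 := by
      ext m
      simp [Finsupp.single_apply]
    rw [h1, map_sum, TensorProduct.tmul_sum]
    refine Finset.sum_congr rfl fun m hm => ?_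
    have h2 : ψ m = 0 := h m (Finsupp.mem_support_iff.1 hm)
    rw [map_smul, toricCoaction_single, h2, TensorProduct.tmul_smul, one_def]

/-- The inclusion into `R[L]` identifies the invariants with the elements supported on lattice
points of `τ` of degree `0`, so matrices can be carried back and forth. -/
theorem invariantsSplit_of_free (ψ : L →+ P) (τ : PointedCone ℚ (ℚ ⊗[ℤ] L))
    (h : ∀ {n : ℕ} (e : Matrix (Fin n) (Fin n) (invariantSubalgebra (toricCoaction R ψ τ))),
      e * e = e → ∃ (m : ℕ) (S : Matrix (Fin n) (Fin m) (invariantSubalgebra (toricCoaction R ψ τ)))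
        (S' : Matrix (Fin m) (Fin n) (invariantSubalgebra (toricCoaction R ψ τ))),
      S * S' = e ∧ S' * S = 1) :
    InvariantsSplit R (latticePoints τ) ψ := by
  let f : invariantSubalgebra (toricCoaction R ψ τ) →+* AddMonoidAlgebra R L :=
    (mapDomainRingHom R (latticePoints τ).subtype).comp
      (invariantSubalgebra (toricCoaction R ψ τ)).val.toRingHom
  have hinj : Function.Injective f := fun x y hxy =>
    Subtype.ext (mapDomain_injective Subtype.val_injective hxy)
  have hsupp : ∀ x, SuppIn {m | m ∈ latticePoints τ ∧ ψ m = 0} (f x) := fun x =>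
    suppIn_mapDomain ((mem_invariantSubalgebra_iff ψ τ x.1).1 x.2)
  have hsurj : ∀ y : AddMonoidAlgebra R L, SuppIn {m | m ∈ latticePoints τ ∧ ψ m = 0} y →
      ∃ x, f x = y := by
    intro y hy
    obtain ⟨x, hx, rfl⟩ := exists_mapDomain_eq hy
    exact ⟨⟨x, (mem_invariantSubalgebra_iff ψ τ x).2 hx⟩, rfl⟩
  intro n e he hee
  have he' : ∀ i j, ∃ x, f x = e i j := fun i j => hsurj _ ((he i j).mono fun m hm => by
    simpa using hm)
  choose e' he' using he'
  have hmap : (Matrix.of e').map f = e := by ext1 i j; exact he' i j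
  obtain ⟨m, S, S', hSS', hS'S⟩ := h (Matrix.of e') (by
    refine Matrix.map_injective hinj ?_
    change (Matrix.of e' * Matrix.of e').map f = _
    exact (Matrix.map_mul).trans (by rw [hmap, hee]; exact hmap.symm))
  refine ⟨m, S.map f, fun i j => (hsupp _).mono fun m hm => by simpa using hm,
    S'.map f, fun i j => (hsupp _).mono fun m hm => by simpa using hm, ?_, ?_⟩
  · rw [← Matrix.map_mul, hSS', hmap]
  · rw [← Matrix.map_mul, hS'S, Matrix.map_one _ (map_zero f) (map_one f)]

end Invariants

/-! ### Lattice points of polyhedral cones -/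

section Cones

variable {L : Type*} [AddCommGroup L] [Module.Free ℤ L] [Module.Finite ℤ L]

theorem exists_integral_multiple (f : ℚ ⊗[ℤ] L →ₗ[ℚ] ℚ) :
    ∃ (N : ℕ) (g : L →+ ℤ), 0 < N ∧ ∀ m, (g m : ℚ) = N * f (1 ⊗ₜ m) := by
  let b := Module.Free.chooseBasis ℤ L
  let N := ∏ i, (f (1 ⊗ₜ b i)).den
  have hN : ∀ i, ∃ z : ℤ, (z : ℚ) = N * f (1 ⊗ₜ b i) := by
    intro i
    obtain ⟨c, hc⟩ : (f (1 ⊗ₜ b i)).den ∣ N := Finset.dvd_prod_of_mem _ (Finset.mem_univ i)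
    refine ⟨c * (f (1 ⊗ₜ b i)).num, ?_⟩
    rw [hc]
    push_cast
    have := Rat.den_mul_eq_num (f (1 ⊗ₜ b i))
    rw [mul_comm ((f (1 ⊗ₜ b i)).den : ℚ), mul_assoc, this]
  choose z hz using hN
  let g : L →ₗ[ℤ] ℤ := b.constr ℤ z
  let f' : L →ₗ[ℤ] ℚ := (N : ℤ) • (f.restrictScalars ℤ ∘ₗ (TensorProduct.mk ℤ ℚ L 1))
  have hf' : ∀ m, f' m = N * f (1 ⊗ₜ m) := fun m => by
    change (N : ℤ) • f (1 ⊗ₜ m) = _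
    simp
  have hgf : (Algebra.linearMap ℤ ℚ) ∘ₗ g = f' := by
    refine b.ext fun i => ?_
    rw [LinearMap.comp_apply, Module.Basis.constr_basis, hf', ← hz]
    rfl
  refine ⟨N, g.toAddMonoidHom, Finset.prod_pos fun i _ => Rat.den_pos _, fun m => ?_⟩
  exact (LinearMap.congr_fun hgf m).trans (hf' m)

/-- Clearing denominators makes the defining functionals integral on `L`. Any subset `Z` of them
cuts out a true face: their sum is nonnegative on the cone and vanishes exactly where each summand
does. -/
theorem exists_face_description {σ : PointedCone ℚ (ℚ ⊗[ℤ] L)} (hσ : IsPolyhedralCone σ) :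
    ∃ (n : ℕ) (l : Fin n → L →+ ℤ), (∀ Z, ∃ τ, IsConeFace τ σ ∧ face l Z = latticePoints τ) ∧
      face l ∅ = latticePoints σ := by
  classical
  obtain ⟨s, hs⟩ := hσ
  let φ := s.equivFin.symm
  choose N l hN hl using fun i => exists_integral_multiple (L := L) (φ i).1
  have hnn : ∀ i m, 0 ≤ l i m ↔ 0 ≤ (φ i).1 (1 ⊗ₜ m) := by
    intro i m
    have h1 : (0 : ℚ) < N i := by exact_mod_cast hN i
    rw [← mul_nonneg_iff_of_pos_left h1, ← hl]
    exact_mod_cast Iff.rfl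
  have hzero : ∀ i m, l i m = 0 ↔ (φ i).1 (1 ⊗ₜ m) = 0 := by
    intro i m
    have h1 : (N i : ℚ) ≠ 0 := by exact_mod_cast (hN i).ne'
    rw [← mul_eq_zero_iff_left h1, ← hl]
    exact_mod_cast Iff.rfl
  have hmem : ∀ y, y ∈ σ ↔ ∀ i, 0 ≤ (φ i).1 y := by
    intro y
    rw [← hs, PointedCone.mem_dual]
    refine ⟨fun h i => h (φ i).2, fun h x hx => ?_⟩
    have := h (s.equivFin ⟨x, hx⟩)
    simpa [φ] using this
  refine ⟨_, l, fun Z => ?_, ?_⟩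
  · let f := ∑ i ∈ Z, (φ i).1
    have hf : ∀ y ∈ σ, f y = 0 ↔ ∀ i ∈ Z, (φ i).1 y = 0 := by
      intro y hy
      rw [LinearMap.sum_apply, Finset.sum_eq_zero_iff_of_nonneg fun i _ => (hmem y).1 hy i]
    let τ : PointedCone ℚ (ℚ ⊗[ℤ] L) := σ ⊓ (LinearMap.ker f).restrictScalars _
    have hτ : ∀ y, y ∈ τ ↔ y ∈ σ ∧ f y = 0 := fun y => by
      simp [τ]
    refine ⟨τ, ⟨f, fun y hy => ?_, hτ⟩, ?_⟩
    · rw [LinearMap.sum_apply]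
      exact Finset.sum_nonneg fun i _ => (hmem y).1 hy i
    · ext m
      change _ ↔ (1 : ℚ) ⊗ₜ m ∈ τ
      rw [hτ, mem_face]
      constructor
      · rintro ⟨h1, h2⟩
        have h3 := (hmem _).2 fun i => (hnn i m).1 (h1 i)
        exact ⟨h3, (hf _ h3).2 fun i hi => (hzero i m).1 (h2 i hi)⟩
      · rintro ⟨h1, h2⟩
        exact ⟨fun i => (hnn i m).2 ((hmem _).1 h1 i), fun i hi => (hzero i m).2 ((hf _ h1).1 h2 i hi)⟩
  · ext m
    change _ ↔ (1 : ℚ) ⊗ₜ m ∈ σ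
    rw [hmem, mem_face]
    simp [hnn]

end Cones

/-! ### Comodules over the group algebra as graded modules -/

section Comodule

variable {R : Type*} [CommRing R] {P : Type*} [AddCommGroup P] {M : Type*} [AddCommGroup M]
  [Module R M]

/-- The elements of degree `p` of a comodule over `R[P]`. -/
noncomputable def homogeneous (ρ : M →ₗ[R] AddMonoidAlgebra R P ⊗[R] M) (p : P) :
    Submodule R M :=
  LinearMap.eqLocus ρ (TensorProduct.mk R _ M (single p 1))

omit [AddCommGroup P] in
theorem mem_homogeneous {ρ : M →ₗ[R] AddMonoidAlgebra R P ⊗[R] M} {p : P} {x : M} :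
    x ∈ homogeneous ρ p ↔ ρ x = single p 1 ⊗ₜ x :=
  Iff.rfl

omit [AddCommGroup P] in
theorem component_of_mem {ρ : M →ₗ[R] AddMonoidAlgebra R P ⊗[R] M} {p : P} {x : M}
    (hx : x ∈ homogeneous ρ p) : component R M p (ρ x) = x := by
  rw [mem_homogeneous.1 hx, component_single, if_pos rfl]

theorem exists_sum_component (t : AddMonoidAlgebra R P ⊗[R] M) :
    ∃ F : Finset P, ∀ F', F ⊆ F' → t = ∑ p ∈ F', single p 1 ⊗ₜ component R M p t := by
  classical
  induction t using TensorProduct.induction_on with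
  | zero => exact ⟨∅, fun F' _ => by simp⟩
  | add t t' h h' =>
    obtain ⟨F, hF⟩ := h
    obtain ⟨F', hF'⟩ := h'
    refine ⟨F ∪ F', fun F'' hF'' => ?_⟩
    simp only [map_add, TensorProduct.tmul_add, Finset.sum_add_distrib]
    rw [← hF _ (Finset.union_subset_left hF''), ← hF' _ (Finset.union_subset_right hF'')]
  | tmul y m =>
    refine ⟨y.coeff.support, fun F' hF' => ?_⟩
    have hy : y = ∑ p ∈ F', y.coeff p • single p (1 : R) := by
      ext p
      simp only [coeff_sum, coeff_smul, coeff_single, Finsupp.coe_finsetSum, Finset.sum_apply,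
        Finsupp.smul_apply, Finsupp.single_apply, smul_eq_mul, mul_ite, mul_one, mul_zero,
        Finset.sum_ite_eq']
      split_ifs with h
      · rfl
      · exact Finsupp.notMem_support_iff.1 fun h' => h (hF' h')
    conv_lhs => rw [hy]
    rw [TensorProduct.sum_tmul]
    exact Finset.sum_congr rfl fun p _ => by rw [component_tmul, TensorProduct.smul_tmul]

variable {ρ : M →ₗ[R] AddMonoidAlgebra R P ⊗[R] M}

theorem exists_eq_sum_component (hρ : IsComodule ρ) (x : M) :
    ∃ F : Finset P, x = ∑ p ∈ F, component R M p (ρ x) := by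
  obtain ⟨F, hF⟩ := exists_sum_component (ρ x)
  refine ⟨F, ?_⟩
  have h := LinearMap.congr_fun hρ.counit x
  simp only [LinearMap.comp_apply, LinearMap.id_apply] at h
  rw [hF F subset_rfl] at h
  simpa using h.symm

/-- Taking the `p`-th component in the first tensor factor of the coassociativity identity gives
`single p 1 ⊗ₜ xₚ` on one side and `ρ xₚ` on the other, with `xₚ` the component of `x`. -/
theorem component_mem (hρ : IsComodule ρ) (p : P) (x : M) :
    component R M p (ρ x) ∈ homogeneous ρ p := by
  have h1 : component R _ p ∘ₗ (TensorProduct.assoc R (AddMonoidAlgebra R P) _ M).toLinearMap ∘ₗ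
      (Coalgebra.comul (R := R) (A := AddMonoidAlgebra R P)).rTensor M =
      TensorProduct.mk R _ M (single p 1) ∘ₗ component R M p := by
    classical
    ext q m
    simp [component_single]
    split_ifs with h
    · rw [h]
    · simp
  have h2 : component R _ p ∘ₗ ρ.lTensor (AddMonoidAlgebra R P) = ρ ∘ₗ component R M p := by
    ext q m
    simp [component_tmul]
  have h3 := congrArg (component R _ p) (LinearMap.congr_fun hρ.coassoc x)
  exact ((LinearMap.congr_fun h1 (ρ x)).symm.trans (h3.trans (LinearMap.congr_fun h2 (ρ x)))).symm

/-- The free comodule with a basis of elements of the given degrees. -/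
noncomputable def freeCoaction (R : Type*) [CommRing R] {V : Type*} [Fintype V] [DecidableEq V]
    (p : V → P) : (V → R) →ₗ[R] AddMonoidAlgebra R P ⊗[R] (V → R) :=
  (Pi.basisFun R V).constr R fun v => single (p v) 1 ⊗ₜ Pi.single v 1

omit [AddCommGroup P] in
theorem freeCoaction_single {V : Type*} [Fintype V] [DecidableEq V] (p : V → P) (v : V) :
    freeCoaction R p (Pi.single v 1) = single (p v) 1 ⊗ₜ Pi.single v 1 := by
  have := (Pi.basisFun R V).constr_basis R
    (fun v => (single (p v) (1 : R) ⊗ₜ[R] (Pi.single v 1 : V → R))) v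
  rwa [Pi.basisFun_apply] at this

theorem isComodule_freeCoaction {V : Type*} [Fintype V] [DecidableEq V] (p : V → P) :
    IsComodule (freeCoaction R p) := by
  constructor
  · refine (Pi.basisFun R V).ext fun v => ?_
    simp [freeCoaction_single]
  · refine (Pi.basisFun R V).ext fun v => ?_
    simp [freeCoaction_single]

end Comodule

/-! ### From graded modules to graded idempotents and back -/

section EquivariantModule

variable {R : Type*} [CommRing R] {P : Type*} [AddCommGroup P] {Q : Type*} [AddCommMonoid Q]
  {deg : Q →+ P} {φ : AddMonoidAlgebra R Q →ₐ[R] AddMonoidAlgebra R P ⊗[R] AddMonoidAlgebra R Q}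
  (hφ : ∀ m, φ (single m 1) = single (deg m) 1 ⊗ₜ single m 1)
  {E : Type*} [AddCommGroup E] [Module R E] [Module (AddMonoidAlgebra R Q) E]
  [IsScalarTower R (AddMonoidAlgebra R Q) E] {ρ : E →ₗ[R] AddMonoidAlgebra R P ⊗[R] E}
  (hρ : IsEquivariantModule φ ρ)

include hφ hρ

theorem single_smul_mem {p : P} {x : E} (hx : x ∈ homogeneous ρ p) (m : Q) :
    single m (1 : R) • x ∈ homogeneous ρ (deg m + p) := by
  rw [mem_homogeneous] at hx ⊢
  rw [hρ.map_smul, hφ, hx, tensorAction_tmul, single_mul_single, one_mul]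

theorem smul_mem {p d : P} {x : E} (hx : x ∈ homogeneous ρ p) {a : AddMonoidAlgebra R Q}
    (ha : SuppIn {m | deg m = d} a) : a • x ∈ homogeneous ρ (d + p) := by
  classical
  have h1 : a = ∑ m ∈ a.coeff.support, a.coeff m • single m 1 := by
    ext m
    simp [Finsupp.single_apply]
  rw [h1, Finset.sum_smul]
  refine Submodule.sum_mem _ fun m hm => ?_
  rw [smul_assoc]
  have h2 : deg m = d := ha m (Finsupp.mem_support_iff.1 hm)
  exact Submodule.smul_mem _ _ (h2 ▸ single_smul_mem hφ hρ hx m)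

theorem component_smul {q : P} {x : E} (hx : x ∈ homogeneous ρ q) (p : P)
    (a : AddMonoidAlgebra R Q) :
    component R E p (ρ (a • x)) = degreePart deg (p - q) a • x := by
  classical
  induction a using AddMonoidAlgebra.induction_linear with
  | zero => simp
  | add a b ha hb => rw [add_smul, map_add, map_add, ha, hb, map_add, add_smul]
  | single m r =>
    have h1 : SuppIn {m' | deg m' = deg m} (single m (1 : R)) := suppIn_single (by simp) 1
    have h2 : (single m r : AddMonoidAlgebra R Q) = r • single m 1 := by simp
    rw [h2, smul_assoc, map_smul ρ r, map_smul (component R E p) r,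
      map_smul (degreePart deg (p - q)) r, smul_assoc,
      mem_homogeneous.1 (single_smul_mem hφ hρ hx m), component_single]
    congr 1
    split_ifs with h
    · rw [← h, add_sub_cancel_right, degreePart_of_suppIn h1]
    · rw [degreePart_of_suppIn_ne (fun h' => h (by rw [h', sub_add_cancel])) h1, zero_smul]

omit hφ in
theorem exists_homogeneous_generators [Module.Finite (AddMonoidAlgebra R Q) E] :
    ∃ (n : ℕ) (g : Fin n → E) (q : Fin n → P), (∀ i, g i ∈ homogeneous ρ (q i)) ∧
      Submodule.span (AddMonoidAlgebra R Q) (Set.range g) = ⊤ := by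
  have htop : Submodule.span (AddMonoidAlgebra R Q) {x | ∃ p, x ∈ homogeneous ρ p} = ⊤ := by
    refine Submodule.eq_top_iff'.2 fun x => ?_
    obtain ⟨F, hF⟩ := exists_eq_sum_component hρ.isComodule x
    rw [hF]
    exact Submodule.sum_mem _ fun p _ =>
      Submodule.subset_span ⟨p, component_mem hρ.isComodule p x⟩
  have hfg := Module.Finite.fg_top (R := AddMonoidAlgebra R Q) (M := E)
  rw [← htop, Submodule.fg_span_iff_fg_span_finset_subset] at hfg
  obtain ⟨s, hs, hspan⟩ := hfg
  choose q hq using fun i => hs (s.equivFin.symm i).2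
  refine ⟨_, fun i => (s.equivFin.symm i).1, q, hq, ?_⟩
  rw [← htop, hspan]
  congr 1
  ext x
  exact ⟨fun ⟨i, hi⟩ => hi ▸ (s.equivFin.symm i).2, fun hx => ⟨s.equivFin ⟨x, hx⟩, by simp⟩⟩

/-- A section `χ` of the presentation by the generators `g` need not be graded, but its
degree-preserving part is again a section. The matrix `e` is this part composed with the
presentation, so it kills all relations. -/
theorem exists_homogeneous_projector [Module.Projective (AddMonoidAlgebra R Q) E] {I : Type*}
    [Fintype I] {g : I → E} {q : I → P} (hg : ∀ i, g i ∈ homogeneous ρ (q i))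
    (hspan : Submodule.span (AddMonoidAlgebra R Q) (Set.range g) = ⊤) :
    ∃ e : Matrix I I (AddMonoidAlgebra R Q), (∀ i j, SuppIn {m | deg m = q j - q i} (e i j)) ∧
      (∀ j, ∑ i, e i j • g i = g j) ∧ ∀ a : I → AddMonoidAlgebra R Q, ∑ j, a j • g j = 0 →
        e.mulVec a = 0 := by
  classical
  let f := Fintype.linearCombination (AddMonoidAlgebra R Q) g
  have hf : Function.Surjective f := by
    rw [← LinearMap.range_eq_top, Fintype.range_linearCombination, hspan]
  obtain ⟨χ, hχ⟩ := Module.projective_lifting_property f LinearMap.id hf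
  have hcomp : ∀ (p : P) (a : I → AddMonoidAlgebra R Q),
      component R E p (ρ (∑ j, a j • g j)) = ∑ j, degreePart deg (p - q j) (a j) • g j := by
    intro p a
    rw [map_sum, map_sum]
    exact Finset.sum_congr rfl fun j _ => component_smul hφ hρ (hg j) p _
  refine ⟨fun i j => degreePart deg (q j - q i) (χ (g j) i), fun i j => suppIn_degreePart _ _ _,
    fun j => ?_, fun a ha => ?_⟩
  · rw [← hcomp]
    have h1 : ∑ i, χ (g j) i • g i = g j := LinearMap.congr_fun hχ (g j)
    rw [h1, component_of_mem (hg j)]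
  · funext i
    refine eq_zero_of_degreePart (deg := deg) fun p' => ?_
    -- The component of the relation `a` in degree `p' + q i` is itself a relation. Applying `χ` and
    -- reading off degree `p'` in coordinate `i` picks out the required part of `e.mulVec a`.
    let c : I → AddMonoidAlgebra R Q := fun j => degreePart deg (p' + q i - q j) (a j)
    have hc : ∑ j, c j • g j = 0 := by rw [← hcomp, ha, map_zero, map_zero]
    have h1 : ∑ j, χ (g j) i * c j = 0 := by
      have := congrFun (congrArg χ hc) i
      rw [map_sum, map_zero, Finset.sum_apply] at this
      simpa [mul_comm] using this
    have h2 := congrArg (degreePart deg p') h1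
    rw [map_sum, map_zero] at h2
    change degreePart deg p' (∑ j, _ * a j) = _
    rw [map_sum, ← h2]
    refine Finset.sum_congr rfl fun j _ => ?_
    have h3 : p' - (q j - q i) = p' + q i - q j := by abel
    have h4 : p' - (p' + q i - q j) = q j - q i := by abel
    rw [mul_comm, degreePart_mul deg (suppIn_degreePart _ _ _),
      degreePart_mul deg (suppIn_degreePart _ _ _), mul_comm, h3, h4]

/-- The columns of `X`, read as combinations of the generators, form the basis. They span because `X
* Y = e` fixes the generators, and are independent because `Y * e * X = 1` while `e` kills
relations. -/
theorem exists_homogeneous_basis {I : Type*} [Fintype I] [DecidableEq I] {g : I → E} {q : I → P}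
    (hg : ∀ i, g i ∈ homogeneous ρ (q i))
    (hspan : Submodule.span (AddMonoidAlgebra R Q) (Set.range g) = ⊤)
    {e : Matrix I I (AddMonoidAlgebra R Q)} (heg : ∀ j, ∑ i, e i j • g i = g j)
    (hrel : ∀ a : I → AddMonoidAlgebra R Q, ∑ j, a j • g j = 0 → e.mulVec a = 0)
    {V : Type*} [Fintype V] [DecidableEq V] {p : V → P}
    {X : Matrix I V (AddMonoidAlgebra R Q)} {Y : Matrix V I (AddMonoidAlgebra R Q)}
    (hX : ∀ i v, SuppIn {m | deg m = p v - q i} (X i v)) (hXY : X * Y = e) (hYX : Y * X = 1) :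
    ∃ b : Module.Basis V (AddMonoidAlgebra R Q) E, ∀ v, b v ∈ homogeneous ρ (p v) := by
  have hXc : ∀ c : V → AddMonoidAlgebra R Q,
      ∑ v, c v • ∑ i, X i v • g i = ∑ i, X.mulVec c i • g i := by
    intro c
    simp only [Finset.smul_sum, Matrix.mulVec, dotProduct, Finset.sum_smul, smul_smul]
    rw [Finset.sum_comm]
    simp only [mul_comm]
  have hli : LinearIndependent (AddMonoidAlgebra R Q) fun v => ∑ i, X i v • g i := by
    rw [Fintype.linearIndependent_iff]
    intro c hc
    rw [hXc] at hc
    have hYeX : Y * e * X = 1 := by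
      rw [← hXY, ← Matrix.mul_assoc, hYX, Matrix.one_mul, hYX]
    have h1 := congrArg Y.mulVec (hrel _ hc)
    rw [Matrix.mulVec_mulVec, Matrix.mulVec_mulVec, hYeX, Matrix.one_mulVec,
      Matrix.mulVec_zero] at h1
    exact fun v => congrFun h1 v
  refine ⟨Module.Basis.mk hli ?_, fun v => ?_⟩
  · rw [← hspan, Submodule.span_le]
    rintro _ ⟨j, rfl⟩
    have h1 : g j = ∑ v, Y v j • ∑ i, X i v • g i := by
      rw [hXc (fun v => Y v j)]
      conv_lhs => rw [← heg j, ← hXY]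
      rfl
    rw [h1]
    exact Submodule.sum_mem _ fun v _ =>
      Submodule.smul_mem _ _ (Submodule.subset_span ⟨v, rfl⟩)
  · rw [Module.Basis.mk_apply]
    refine Submodule.sum_mem _ fun i _ => ?_
    have := smul_mem hφ hρ (hg i) (hX i v)
    rwa [sub_add_cancel] at this

theorem exists_equivariant_equiv {V : Type*} [Fintype V] [DecidableEq V] {p : V → P}
    (b : Module.Basis V (AddMonoidAlgebra R Q) E) (hb : ∀ v, b v ∈ homogeneous ρ (p v)) :
    ∃ e : E ≃ₗ[AddMonoidAlgebra R Q] AddMonoidAlgebra R Q ⊗[R] (V → R),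
      IsEquivariantMap ρ (baseChangeCoaction φ (freeCoaction R p))
        (e.toLinearMap.restrictScalars R) := by
  let e := b.equiv (Algebra.TensorProduct.basis (AddMonoidAlgebra R Q) (Pi.basisFun R V))
    (Equiv.refl V)
  have he : ∀ v (a : AddMonoidAlgebra R Q), e (a • b v) = a ⊗ₜ Pi.single v 1 := by
    intro v a
    rw [map_smul, Module.Basis.equiv_apply]
    simp [TensorProduct.smul_tmul']
  refine ⟨e, ?_⟩
  let l := baseChangeCoaction φ (freeCoaction R p) ∘ₗ e.toLinearMap.restrictScalars R
  let r := (e.toLinearMap.restrictScalars R).lTensor (AddMonoidAlgebra R P) ∘ₗ ρ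
  change l = r
  have key : ∀ v (a : AddMonoidAlgebra R Q), l (a • b v) = r (a • b v) := by
    intro v a
    induction a using AddMonoidAlgebra.induction_linear with
    | zero => simp
    | add a a' h h' => rw [add_smul, map_add, map_add, h, h']
    | single m s =>
      have h2 : (single m s : AddMonoidAlgebra R Q) = s • single m 1 := by simp
      rw [h2, smul_assoc, map_smul l s, map_smul r s]
      congr 1
      change baseChangeCoaction φ (freeCoaction R p) (e (single m (1 : R) • b v)) =
        (e.toLinearMap.restrictScalars R).lTensor _ (ρ (single m (1 : R) • b v))
      rw [mem_homogeneous.1 (single_smul_mem hφ hρ (hb v) m), LinearMap.lTensor_tmul]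
      change _ = _ ⊗ₜ e (single m (1 : R) • b v)
      rw [he]
      simp [baseChangeCoaction, hφ, freeCoaction_single, single_mul_single]
  ext x
  rw [← b.sum_repr x, map_sum, map_sum]
  exact Finset.sum_congr rfl fun v _ => key v _

end EquivariantModule

theorem splits_submonoidAlgebra {R : Type*} [CommRing R] {L : Type*} [AddCommGroup L] {P : Type*}
    [AddCommGroup P] {S : AddSubmonoid L} {ψ : L →+ P} {I : Type*} [Fintype I] [DecidableEq I]
    {V : Type*} [Fintype V] [DecidableEq V] {q : I → P} {p : V → P}
    {e : Matrix I I (AddMonoidAlgebra R S)}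
    (h : Splits S ψ q p (e.map (mapDomainRingHom R S.subtype))) :
    ∃ (X : Matrix I V (AddMonoidAlgebra R S)) (Y : Matrix V I (AddMonoidAlgebra R S)),
      (∀ i v, SuppIn {m : S | ψ m = p v - q i} (X i v)) ∧ X * Y = e ∧ Y * X = 1 := by
  obtain ⟨X, hX, Y, hY, hXY, hYX⟩ := h
  choose X' hX' hX'X using fun i v => exists_mapDomain_eq (hX i v)
  choose Y' hY' hY'Y using fun v i => exists_mapDomain_eq (hY v i)
  have hinj : Function.Injective (mapDomainRingHom R S.subtype) :=
    mapDomain_injective Subtype.val_injective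
  have hXm : (Matrix.of X').map (mapDomainRingHom R S.subtype) = X := by
    ext1 i v; exact hX'X i v
  have hYm : (Matrix.of Y').map (mapDomainRingHom R S.subtype) = Y := by
    ext1 i v; exact hY'Y i v
  refine ⟨Matrix.of X', Matrix.of Y', hX', ?_, ?_⟩
  · refine Matrix.map_injective hinj (Matrix.map_mul.trans ?_)
    rw [hXm, hYm, hXY]
  · refine Matrix.map_injective hinj (Matrix.map_mul.trans ?_)
    rw [hXm, hYm, hYX]
    exact (Matrix.map_one _ (map_zero _) (map_one _)).symm

end GradedMatrix

/-! ### The main theorem -/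

open GradedMatrix in
theorem mainTheorem1
    {R : Type u} [CommRing R] [IsNoetherianRing R] (hR : SatisfiesDagger R)
    {P : Type v} [AddCommGroup P] [AddGroup.FG P]
    {L : Type w} [AddCommGroup L] [Module.Free ℤ L] [Module.Finite ℤ L]
    (ψ : L →+ P)
    (σ : PointedCone ℚ (ℚ ⊗[ℤ] L)) (hσ : IsPolyhedralCone σ)
    (hσ_span : Submodule.span ℚ (σ : Set (ℚ ⊗[ℤ] L)) = ⊤)
    (hA : ∀ τ : PointedCone ℚ (ℚ ⊗[ℤ] L), IsConeFace τ σ →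
      FGProjectivesExtended R (ToricRing R τ) ∧
      FGProjectivesExtended R (invariantSubalgebra (toricCoaction R ψ τ)))
    (E : Type x) [AddCommGroup E] [Module R E] [Module (ToricRing R σ) E]
    [IsScalarTower R (ToricRing R σ) E]
    [Module.Finite (ToricRing R σ) E] [Module.Projective (ToricRing R σ) E]
    (ρ : E →ₗ[R] AddMonoidAlgebra R P ⊗[R] E)
    (hρ : IsEquivariantModule (toricCoaction R ψ σ) ρ) :
    ∃ (F : Type u) (_ : AddCommGroup F) (_ : Module R F)
      (ρF : F →ₗ[R] AddMonoidAlgebra R P ⊗[R] F),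
      Module.Finite R F ∧ Module.Projective R F ∧ IsComodule ρF ∧
      ∃ e : E ≃ₗ[ToricRing R σ] ToricRing R σ ⊗[R] F,
        IsEquivariantMap ρ (baseChangeCoaction (toricCoaction R ψ σ) ρF)
          (e.toLinearMap.restrictScalars R) := by
  classical
  obtain ⟨n, l, hface, hlσ⟩ := exists_face_description hσ
  have HS : ∀ Z, InvariantsSplit R (face l Z) ψ := by
    intro Z
    obtain ⟨τ, hτ, hlτ⟩ := hface Z
    rw [hlτ]
    exact invariantsSplit_of_free ψ τ
      (exists_split_of_free fun M => free_of_extended hR (hA τ hτ).2 M)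
  have hφ : ∀ m : latticePoints σ, toricCoaction R ψ σ (AddMonoidAlgebra.single m 1) =
      AddMonoidAlgebra.single (ψ.comp (latticePoints σ).subtype m) 1 ⊗ₜ
        AddMonoidAlgebra.single m 1 := toricCoaction_single R ψ σ
  obtain ⟨k, g, q, hg, hspan⟩ := exists_homogeneous_generators hρ
  obtain ⟨e, he, heg, hrel⟩ := exists_homogeneous_projector hφ hρ hg hspan
  have hee : e * e = e := by
    -- The columns of `1 - e` are relations among the generators, since `e` fixes each generator.
    have hker : e * (1 - e) = 0 := by
      ext1 i j
      refine congrFun (hrel (fun i => (1 - e) i j) ?_) i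
      simp only [Matrix.sub_apply, sub_smul, Finset.sum_sub_distrib, heg]
      simp [Matrix.one_apply]
    rw [mul_sub, mul_one, sub_eq_zero] at hker
    exact hker.symm
  let f := AddMonoidAlgebra.mapDomainRingHom R (latticePoints σ).subtype
  have hef : e.map f ∈ Gr R (face l ∅) ψ q q := by
    rw [hlσ]
    exact fun i j => suppIn_mapDomain (he i j)
  obtain ⟨V, _, _, p, hp⟩ := exists_splits HS hef (by rw [← Matrix.map_mul, hee])
  rw [hlσ] at hp
  obtain ⟨X, Y, hX, hXY, hYX⟩ := splits_submonoidAlgebra hp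
  obtain ⟨b, hb⟩ := exists_homogeneous_basis hφ hρ hg hspan heg hrel hX hXY hYX
  exact ⟨V → R, inferInstance, inferInstance, freeCoaction R p, inferInstance, inferInstance,
    isComodule_freeCoaction p, exists_equivariant_equiv hφ hρ b hb⟩
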